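/- All structured categories carry chosen structure. A *regular category* is a category with chosen finite limits (presented by a terminal object and pullbacks), chosen image factorisations $f = (\text{mono})\circ(\text{cover})$, and pullback-stable covers, where a *cover* is a map that does not factor through any proper subobject of its target; a *regular functor* is one preserving finite limits and covers. A *topos* is a regular category with power-objects and a natural numbers object (NNO); a *logical functor* is a regular functor preserving (the universal properties of) NNO and power-objects. An *$\infty$-ranked topos* is a regular category $\mathcal E$ with NNO and classes of objects $\mathcal E_0\subseteq\mathcal E_1\subseteq\cdots\subseteq\operatorname{ob}\mathcal E$ such that each $\mathcal E_i$, as a full subcategory, is a regular subcategory (it has its own chosen regular structure, and the inclusion into $\mathcal E$ is a regular functor) containing the NNO, and each object of $\mathcal E_i$ has a chosen power-object in $\mathcal E$, lying in $\mathcal E_{i+1}$. A functor $F:\mathcal E\to\mathcal F$ of $\infty$-ranked toposes *preserves rank* if $FX$ is isomorphic to an object of $\mathcal F_i$ whenever $X\in\mathcal E_i$. A functor is *strictly logical* (resp. *strictly $\infty$-logical*) if it preserves all the chosen structure (resp. all the chosen structure, including that on each $\mathcal E_i$, and membership in each $\mathcal E_i$) on the nose. The *free topos* $\mathbf T$ is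 the initial object of the category of small toposes and strictly logical functors; the *free $\infty$-ranked topos* $\mathbf T_\infty$ is the initial object of the category of small $\infty$-ranked toposes and strictly $\infty$-logical functors. **Proposition.** $\mathbf T$ and $\mathbf T_\infty$ exist, and the free $\infty$-ranked topos is equivalent to the free topos. More precisely: 1. the underlying category of $\mathbf T_\infty$ is a topos, and there is an equivalence of categories $\mathbf T\simeq\mathbf T_\infty$ whose two functors are logical; 2. every functor from $\mathbf T_\infty$ to a locally small $\infty$-ranked topos that preserves the regular structure, the NNO and the assumed power-objects of $\mathbf T_\infty$ automatically preserves rank; 3. $\mathbf T$ and $\mathbf T_\infty$ are both bi-initial in the 2-category of locally small toposes, logical functors and natural isomorphisms: for each locally small topos $\mathcal E$ there is a logical functor to $\mathcal E$, and between any two such functors there is exactly one natural isomorphism. -/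

import Mathlib

open CategoryTheory CategoryTheory.Limits

universe w u v u₁ v₁ u₂ v₂ u₃ v₃

namespace RankedTopos

section Notions

variable {C : Type u₁} [Category.{v₁} C]

/-- A cover: a map that does not factor through any proper subobject of its target. -/
def IsCover {X Y : C} (f : X ⟶ Y) : Prop :=
  ∀ ⦃S : C⦄ (m : S ⟶ Y) [Mono m] (g : X ⟶ S), g ≫ m = f → IsIso m

/-- `(zero, succ)` is a natural numbers object (in particular, its base point is a map out of
a terminal object). -/
def IsNNO {T N : C} (zero : T ⟶ N) (succ : N ⟶ N) : Prop :=
  Nonempty (IsTerminal T) ∧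
    ∀ ⦃X : C⦄ (a : T ⟶ X) (t : X ⟶ X), ∃! h : N ⟶ X, zero ≫ h = a ∧ succ ≫ h = h ≫ t

/-- A relation `(p, q)` from `X` to `Y`, i.e. a jointly monic pair.  When the product `X × Y`
exists, this says that the induced map `R ⟶ X × Y` is a monomorphism. -/
def IsRelation {R X Y : C} (p : R ⟶ X) (q : R ⟶ Y) : Prop :=
  ∀ ⦃Z : C⦄ (a b : Z ⟶ R), a ≫ p = b ≫ p → a ≫ q = b ≫ q → a = b

/-- `R` is the pullback of `M ↪ P × A` along `χ × A : B × A ⟶ P × A`.  A map into that pullback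
is a map `b` into `B` together with a map `m` into `M` such that `χ b` is the first component
of `m`; so the pullback is that of `M ⟶ P` along `χ`, the component of `R` at `A` being the
composite `R ⟶ M ⟶ A`. -/
def Classifies {A P M B R : C} (memP : M ⟶ P) (memA : M ⟶ A) (r : R ⟶ B) (s : R ⟶ A)
    (χ : B ⟶ P) : Prop :=
  ∃ k : R ⟶ M, IsPullback k r memP χ ∧ k ≫ memA = s

/-- `P`, with the membership relation `M ↪ P × A`, is a power-object of `A`: every relation
`R ↪ B × A` is the pullback of membership along `χ × A` for a unique `χ : B ⟶ P`. -/
def IsPowerObject {A P M : C} (memP : M ⟶ P) (memA : M ⟶ A) : Prop :=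
  IsRelation memP memA ∧
    ∀ ⦃B R : C⦄ (r : R ⟶ B) (s : R ⟶ A), IsRelation r s →
      ∃! χ : B ⟶ P, Classifies memP memA r s χ

/-- A (chosen) power-object of `A`. -/
structure PowerObject (A : C) where
  pow : C
  mem : C
  memPow : mem ⟶ pow
  memBase : mem ⟶ A
  isPowerObject : IsPowerObject memPow memBase

end Notions

/-! ### Categories with chosen structure -/

section Structures

variable (C : Type u₁) [Category.{v₁} C]

/-- A regular category with chosen structure: finite limits (presented by a terminal object and
pullbacks), image factorisations, and pullback-stability of covers. -/
structure RegularStr where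
  one : C
  isTerminal : IsTerminal one
  pb : ∀ {X Y Z : C}, (X ⟶ Z) → (Y ⟶ Z) → C
  pbFst : ∀ {X Y Z : C} (f : X ⟶ Z) (g : Y ⟶ Z), pb f g ⟶ X
  pbSnd : ∀ {X Y Z : C} (f : X ⟶ Z) (g : Y ⟶ Z), pb f g ⟶ Y
  isPullback : ∀ {X Y Z : C} (f : X ⟶ Z) (g : Y ⟶ Z), IsPullback (pbFst f g) (pbSnd f g) f g
  im : ∀ {X Y : C}, (X ⟶ Y) → C
  imCover : ∀ {X Y : C} (f : X ⟶ Y), X ⟶ im f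
  imMono : ∀ {X Y : C} (f : X ⟶ Y), im f ⟶ Y
  im_fac : ∀ {X Y : C} (f : X ⟶ Y), imCover f ≫ imMono f = f
  isCover_imCover : ∀ {X Y : C} (f : X ⟶ Y), IsCover (imCover f)
  mono_imMono : ∀ {X Y : C} (f : X ⟶ Y), Mono (imMono f)
  cover_stable : ∀ {P X Y Z : C} {fst : P ⟶ X} {snd : P ⟶ Y} {f : X ⟶ Z} {g : Y ⟶ Z},
    IsPullback fst snd f g → IsCover g → IsCover fst

variable {C} in
/-- A chosen natural numbers object. -/
structure NNOStr (S : RegularStr C) where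
  nat : C
  zero : S.one ⟶ nat
  succ : nat ⟶ nat
  isNNO : IsNNO zero succ

/-- An elementary topos with NNO, with chosen structure: a regular category with power-objects
and a natural numbers object. -/
structure ToposStr where
  reg : RegularStr C
  nno : NNOStr reg
  power : ∀ A : C, PowerObject A

/-- A category is a topos (always: elementary topos with NNO) if it carries topos structure. -/
def IsTopos : Prop := Nonempty (ToposStr C)

end Structures

/-! ### Functors preserving structure, weakly -/

section WeakFunctors

variable {C : Type u₁} [Category.{v₁} C] {D : Type u₂} [Category.{v₂} D]

/-- Regular functors: they preserve finite limits and covers, hence image factorisations. -/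
structure IsRegularFunctor (F : C ⥤ D) : Prop where
  preservesFiniteLimits : PreservesFiniteLimits F
  map_cover : ∀ {X Y : C} (f : X ⟶ Y), IsCover f → IsCover (F.map f)

/-- Preservation of natural numbers objects. -/
def PreservesNNO (F : C ⥤ D) : Prop :=
  ∀ {T N : C} (zero : T ⟶ N) (succ : N ⟶ N), IsNNO zero succ → IsNNO (F.map zero) (F.map succ)

/-- Logical functors between toposes. -/
structure IsLogical (F : C ⥤ D) : Prop where
  regular : IsRegularFunctor F
  nno : PreservesNNO F
  power : ∀ {A P M : C} (memP : M ⟶ P) (memA : M ⟶ A),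
    IsPowerObject memP memA → IsPowerObject (F.map memP) (F.map memA)

end WeakFunctors

/-! ### `∞`-ranked toposes -/

/-- An `∞`-ranked topos, with chosen structure: a regular category with NNO, with an increasing
sequence `rank i` of classes of objects (viewed as full subcategories), each of them a regular
subcategory (with its own chosen regular structure, the inclusion being a regular functor) that
contains the NNO, and such that each object of `rank i` has a chosen power-object in the ambient
category, lying in `rank (i + 1)`. -/
structure RankedToposStr (C : Type u₁) [Category.{v₁} C] where
  reg : RegularStr C
  nno : NNOStr reg
  rank : ℕ → ObjectProperty C
  rank_mono : ∀ i, rank i ≤ rank (i + 1)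
  rankReg : ∀ i, RegularStr (rank i).FullSubcategory
  rank_regular : ∀ i, IsRegularFunctor (rank i).ι
  nat_mem : ∀ i, rank i nno.nat
  power : ∀ (i : ℕ) (A : C), rank i A → PowerObject A
  power_mem : ∀ (i : ℕ) (A : C) (h : rank i A), rank (i + 1) (power i A h).pow

section WeakRankedFunctors

variable {C : Type u₁} [Category.{v₁} C] {D : Type u₂} [Category.{v₂} D]

/-- A functor from an `∞`-ranked topos that preserves the regular structure, the NNO and the
assumed power-objects, but not necessarily rank. -/
structure IsLogicalFrom (S : RankedToposStr C) (F : C ⥤ D) : Prop where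
  regular : IsRegularFunctor F
  nno : PreservesNNO F
  power : ∀ (i : ℕ) (A : C) (h : S.rank i A),
    IsPowerObject (F.map (S.power i A h).memPow) (F.map (S.power i A h).memBase)

/-- (Weak) preservation of rank. -/
def PreservesRank (S : RankedToposStr C) (S' : RankedToposStr D) (F : C ⥤ D) : Prop :=
  ∀ (i : ℕ) (X : C), S.rank i X → ∃ Y : D, S'.rank i Y ∧ Nonempty (F.obj X ≅ Y)

end WeakRankedFunctors

/-! ### Functors preserving structure strictly

Preservation of a chosen map on the nose is stated as an equality of objects of the arrow
category, which comprises the equalities of sources and of targets. -/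

section StrictFunctors

variable {C : Type u₁} [Category.{v₁} C] {D : Type u₂} [Category.{v₂} D]
  {E : Type u₃} [Category.{v₃} E]

/-- Strictly regular functors. -/
structure IsStrictRegular (S : RegularStr C) (S' : RegularStr D) (F : C ⥤ D) : Prop where
  one : F.obj S.one = S'.one
  pbFst : ∀ {X Y Z : C} (f : X ⟶ Z) (g : Y ⟶ Z),
    Arrow.mk (F.map (S.pbFst f g)) = Arrow.mk (S'.pbFst (F.map f) (F.map g))
  pbSnd : ∀ {X Y Z : C} (f : X ⟶ Z) (g : Y ⟶ Z),
    Arrow.mk (F.map (S.pbSnd f g)) = Arrow.mk (S'.pbSnd (F.map f) (F.map g))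
  imCover : ∀ {X Y : C} (f : X ⟶ Y),
    Arrow.mk (F.map (S.imCover f)) = Arrow.mk (S'.imCover (F.map f))
  imMono : ∀ {X Y : C} (f : X ⟶ Y),
    Arrow.mk (F.map (S.imMono f)) = Arrow.mk (S'.imMono (F.map f))

/-- Strict preservation of the chosen natural numbers object. -/
structure IsStrictNNO {S : RegularStr C} {S' : RegularStr D} (N : NNOStr S) (N' : NNOStr S')
    (F : C ⥤ D) : Prop where
  zero : Arrow.mk (F.map N.zero) = Arrow.mk N'.zero
  succ : Arrow.mk (F.map N.succ) = Arrow.mk N'.succ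

/-- `F` maps a chosen power-object of `A` on the nose to a chosen power-object of `F A`. -/
structure IsStrictPower {A : C} (F : C ⥤ D) (P : PowerObject A) (P' : PowerObject (F.obj A)) :
    Prop where
  memPow : Arrow.mk (F.map P.memPow) = Arrow.mk P'.memPow
  memBase : Arrow.mk (F.map P.memBase) = Arrow.mk P'.memBase

/-- Strictly logical functors between toposes. -/
structure IsStrictLogical (S : ToposStr C) (S' : ToposStr D) (F : C ⥤ D) : Prop where
  reg : IsStrictRegular S.reg S'.reg F
  nno : IsStrictNNO S.nno S'.nno F
  power : ∀ A : C, IsStrictPower F (S.power A) (S'.power (F.obj A))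

/-- The functor between full subcategories induced by a functor. -/
abbrev restrict {P : ObjectProperty C} {Q : ObjectProperty D} (F : C ⥤ D)
    (h : ∀ X, P X → Q (F.obj X)) : P.FullSubcategory ⥤ Q.FullSubcategory :=
  Q.lift (P.ι ⋙ F) fun X ↦ h X.obj X.property

/-- Strictly `∞`-logical functors between `∞`-ranked toposes: all the chosen structure
(including that on each rank) and the rank are preserved strictly. -/
structure IsStrictRankedLogical (S : RankedToposStr C) (S' : RankedToposStr D) (F : C ⥤ D) :
    Prop where
  reg : IsStrictRegular S.reg S'.reg F
  nno : IsStrictNNO S.nno S'.nno F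
  rank : ∀ (i : ℕ) (X : C), S.rank i X → S'.rank i (F.obj X)
  rankReg : ∀ i : ℕ, IsStrictRegular (S.rankReg i) (S'.rankReg i) (restrict F (rank i))
  power : ∀ (i : ℕ) (A : C) (h : S.rank i A),
    IsStrictPower F (S.power i A h) (S'.power i (F.obj A) (rank i A h))

theorem arrow_comp {F : C ⥤ D} {G : D ⥤ E} {X Y : C} {f : X ⟶ Y} {A B : D} {g : A ⟶ B}
    {k : Arrow E} (h : Arrow.mk (F.map f) = Arrow.mk g) (h' : Arrow.mk (G.map g) = k) :
    Arrow.mk ((F ⋙ G).map f) = k :=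
  (congrArg G.mapArrow.obj h).trans h'

theorem IsStrictRegular.id (S : RegularStr C) : IsStrictRegular S S (𝟭 C) :=
  ⟨rfl, fun _ _ ↦ rfl, fun _ _ ↦ rfl, fun _ ↦ rfl, fun _ ↦ rfl⟩

theorem IsStrictRegular.comp {S : RegularStr C} {S' : RegularStr D} {S'' : RegularStr E}
    {F : C ⥤ D} {G : D ⥤ E} (hF : IsStrictRegular S S' F) (hG : IsStrictRegular S' S'' G) :
    IsStrictRegular S S'' (F ⋙ G) where
  one := (congrArg G.obj hF.one).trans hG.one
  pbFst _ _ := arrow_comp (hF.pbFst _ _) (hG.pbFst _ _)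
  pbSnd _ _ := arrow_comp (hF.pbSnd _ _) (hG.pbSnd _ _)
  imCover _ := arrow_comp (hF.imCover _) (hG.imCover _)
  imMono _ := arrow_comp (hF.imMono _) (hG.imMono _)

theorem IsStrictNNO.id {S : RegularStr C} (N : NNOStr S) : IsStrictNNO N N (𝟭 C) := ⟨rfl, rfl⟩

theorem IsStrictNNO.comp {S : RegularStr C} {S' : RegularStr D} {S'' : RegularStr E}
    {N : NNOStr S} {N' : NNOStr S'} {N'' : NNOStr S''} {F : C ⥤ D} {G : D ⥤ E}
    (hF : IsStrictNNO N N' F) (hG : IsStrictNNO N' N'' G) : IsStrictNNO N N'' (F ⋙ G) :=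
  ⟨arrow_comp hF.zero hG.zero, arrow_comp hF.succ hG.succ⟩

theorem IsStrictPower.id {A : C} (P : PowerObject A) : IsStrictPower (𝟭 C) P P := ⟨rfl, rfl⟩

theorem IsStrictPower.comp {F : C ⥤ D} {G : D ⥤ E} {A : C} {P : PowerObject A}
    {P' : PowerObject (F.obj A)} {P'' : PowerObject (G.obj (F.obj A))}
    (hF : IsStrictPower F P P') (hG : IsStrictPower G P' P'') :
    IsStrictPower (F ⋙ G) P P'' :=
  ⟨arrow_comp hF.memPow hG.memPow, arrow_comp hF.memBase hG.memBase⟩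

theorem IsStrictLogical.id (S : ToposStr C) : IsStrictLogical S S (𝟭 C) :=
  ⟨.id _, .id _, fun _ ↦ .id _⟩

theorem IsStrictLogical.comp {S : ToposStr C} {S' : ToposStr D} {S'' : ToposStr E}
    {F : C ⥤ D} {G : D ⥤ E} (hF : IsStrictLogical S S' F) (hG : IsStrictLogical S' S'' G) :
    IsStrictLogical S S'' (F ⋙ G) :=
  ⟨hF.reg.comp hG.reg, hF.nno.comp hG.nno, fun A ↦ (hF.power A).comp (hG.power _)⟩

theorem IsStrictRankedLogical.id (S : RankedToposStr C) : IsStrictRankedLogical S S (𝟭 C) where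
  reg := .id _
  nno := .id _
  rank _ _ h := h
  rankReg _ := .id _
  power _ _ _ := .id _

theorem IsStrictRankedLogical.comp {S : RankedToposStr C} {S' : RankedToposStr D}
    {S'' : RankedToposStr E} {F : C ⥤ D} {G : D ⥤ E} (hF : IsStrictRankedLogical S S' F)
    (hG : IsStrictRankedLogical S' S'' G) : IsStrictRankedLogical S S'' (F ⋙ G) where
  reg := hF.reg.comp hG.reg
  nno := hF.nno.comp hG.nno
  rank i X h := hG.rank i _ (hF.rank i X h)
  rankReg i := (hF.rankReg i).comp (hG.rankReg i)
  power i A h := (hF.power i A h).comp (hG.power i _ _)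

end StrictFunctors

/-! ### The `1`-categories of strict toposes and of strict `∞`-ranked toposes -/

/-- A small topos with chosen structure. -/
structure StrTopos : Type (w + 1) where
  carrier : Type w
  [cat : SmallCategory carrier]
  str : ToposStr carrier

instance StrTopos.coeSort : CoeSort StrTopos.{w} (Type w) := ⟨StrTopos.carrier⟩

instance StrTopos.smallCategory (T : StrTopos.{w}) : SmallCategory T := T.cat

/-- The `1`-category of small toposes and strictly logical functors. -/
instance StrTopos.category : Category StrTopos.{w} where
  Hom T T' := { F : T ⥤ T' // IsStrictLogical T.str T'.str F }
  id T := ⟨𝟭 T, .id _⟩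
  comp F G := ⟨F.1 ⋙ G.1, F.2.comp G.2⟩

/-- A small `∞`-ranked topos with chosen structure. -/
structure StrRankedTopos : Type (w + 1) where
  carrier : Type w
  [cat : SmallCategory carrier]
  str : RankedToposStr carrier

instance StrRankedTopos.coeSort : CoeSort StrRankedTopos.{w} (Type w) := ⟨StrRankedTopos.carrier⟩

instance StrRankedTopos.smallCategory (R : StrRankedTopos.{w}) : SmallCategory R := R.cat

/-- The `1`-category of small `∞`-ranked toposes and strictly `∞`-logical functors. -/
instance StrRankedTopos.category : Category StrRankedTopos.{w} where
  Hom R R' := { F : R ⥤ R' // IsStrictRankedLogical R.str R'.str F }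
  id R := ⟨𝟭 R, .id _⟩
  comp F G := ⟨F.1 ⋙ G.1, F.2.comp G.2⟩

/-- `T` is the free topos: initial among toposes and strictly logical functors. -/
def IsFreeTopos (T : StrTopos.{w}) : Prop := Nonempty (IsInitial T)

/-- `R` is the free `∞`-ranked topos: initial among `∞`-ranked toposes and strictly `∞`-logical
functors. -/
def IsFreeRankedTopos (R : StrRankedTopos.{w}) : Prop := Nonempty (IsInitial R)

/-! ### Bi-initiality -/

/-- `C` is bi-initial in the `2`-category of locally small toposes, logical functors and natural
isomorphisms: each hom-category out of `C` is contractible. -/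
def IsBiInitialTopos (C : Type u₁) [Category.{v₁} C] : Prop :=
  IsTopos C ∧ ∀ (E : Type u) [Category.{v} E], IsTopos E →
    (∃ F : C ⥤ E, IsLogical F) ∧
    ∀ F G : C ⥤ E, IsLogical F → IsLogical G → Nonempty (Unique (F ≅ G))

end RankedTopos

namespace RankedTopos

/-! ### Covers, relations and regular functors -/

section Basics

variable {C : Type u₁} [Category.{v₁} C]

/-! Existence is a generation argument. Each operation of an `∞`-ranked topos (chosen limit or
image, induced map, recursor, power-object, classifying map) has at most one result on a given
finite list of maps, so the substructure generated by the empty set is countable. Inside the product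
of all small `∞`-ranked toposes this gives a weakly initial one (`exists_strRankedTopos_family`).
The maps on which given strict functors agree also form a substructure (`isClosed_equalizer`), and a
weakly initial object together with such equalising substructures yields an initial object
(`exists_isInitial`). A topos is an `∞`-ranked topos all of whose objects have rank `0`, so the same
argument produces the free topos.

The rest uses only a fragment of initiality, `IsRigid`: a small `P` admits a single functor that is
a section of every strict functor from `P` to the free object. If `P` is the full subcategory on a
class of objects closed under the constructions, the section shows that the class contains every
object (`IsRigid.induction`). If `P` consists of the triples `(X, Y, F X ≅ G Y)`, it carries
structure for which both projections are strict, and their common section is an isomorphism `F ≅ G`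
(`IsRigid.nonempty_iso`). By induction over objects, that isomorphism is unique
(`isInductive_app_eq`).

Induction also shows that every object of the free `∞`-ranked topos is isomorphic to one of some
rank. The delicate case is the membership object, which is a pullback of `true : 1 ⟶ Ω`. So all
power-objects exist and the category is a topos. Any structure-preserving functor out of it is
isomorphic to a strict one, hence preserves rank. Logical functors exist in both directions between
the two free objects, and uniqueness up to isomorphism makes them an equivalence. -/

theorem IsCover.comp_isIso {X Y Z : C} {f : X ⟶ Y} (hf : IsCover f) (i : Y ⟶ Z) [IsIso i] :
    IsCover (f ≫ i) := by
  intro S m _ g h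
  have : IsIso (m ≫ inv i) := hf (m ≫ inv i) g (by simp [reassoc_of% h])
  exact IsIso.of_isIso_comp_right m (inv i)

theorem IsCover.isIso_comp {X Y Z : C} {f : Y ⟶ Z} (hf : IsCover f) (i : X ⟶ Y) [IsIso i] :
    IsCover (i ≫ f) := by
  intro S m _ g h
  exact hf m (inv i ≫ g) (by simp [h])

/-- Image factorisations are unique up to isomorphism. -/
theorem exists_iso_of_fac [HasPullbacks C] {X I I' Y : C} {e : X ⟶ I} {m : I ⟶ Y} {e' : X ⟶ I'}
    {m' : I' ⟶ Y} [Mono m] [Mono m'] (he : IsCover e) (he' : IsCover e')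
    (h : e ≫ m = e' ≫ m') : ∃ θ : I ≅ I', e ≫ θ.hom = e' ∧ θ.hom ≫ m' = m := by
  have : IsIso (pullback.fst m m') := he _ (pullback.lift e e' h) (pullback.lift_fst _ _ _)
  have : IsIso (pullback.snd m m') := he' _ (pullback.lift e e' h) (pullback.lift_snd _ _ _)
  refine ⟨(asIso (pullback.fst m m')).symm ≪≫ asIso (pullback.snd m m'), ?_, ?_⟩
  · have : e ≫ inv (pullback.fst m m') = pullback.lift e e' h := by
      rw [IsIso.comp_inv_eq, pullback.lift_fst]
    simpa [reassoc_of% this] using pullback.lift_snd _ _ h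
  · simp [← pullback.condition]

theorem IsRelation.of_isPullback {W X Y Z : C} {p : W ⟶ X} {q : W ⟶ Y} {f : X ⟶ Z} {g : Y ⟶ Z}
    (h : IsPullback p q f g) : IsRelation p q := fun _ _ _ ↦ h.hom_ext

theorem IsRelation.of_mono {X Y : C} (m : X ⟶ Y) [Mono m] : IsRelation m m :=
  fun _ _ _ h _ ↦ (cancel_mono m).1 h

theorem RegularStr.hasTerminal (S : RegularStr C) : HasTerminal C := S.isTerminal.hasTerminal

theorem RegularStr.hasPullbacks (S : RegularStr C) : HasPullbacks C := by
  have {X Y Z : C} {f : X ⟶ Z} {g : Y ⟶ Z} : HasLimit (cospan f g) := (S.isPullback f g).hasPullback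
  exact hasPullbacks_of_hasLimit_cospan C

end Basics

/-! ### Regular functors; uniqueness and transport of natural numbers objects and power-objects. -/

section Functors

variable {C : Type u₁} [Category.{v₁} C] {D : Type u₂} [Category.{v₂} D]
  {E : Type u₃} [Category.{v₃} E]

/-- Limits are unique up to isomorphism, so one preserved limit cone per diagram suffices. -/
theorem preservesFiniteLimits_of_exists {F : C ⥤ D}
    (h₁ : ∃ T : C, Nonempty (IsTerminal T) ∧ Nonempty (IsTerminal (F.obj T)))
    (h₂ : ∀ ⦃X Y Z : C⦄ (f : X ⟶ Z) (g : Y ⟶ Z), ∃ (P : C) (fst : P ⟶ X) (snd : P ⟶ Y),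
        IsPullback fst snd f g ∧ IsPullback (F.map fst) (F.map snd) (F.map f) (F.map g)) :
    PreservesFiniteLimits F := by
  obtain ⟨T, ⟨hT⟩, ⟨hFT⟩⟩ := h₁
  have : HasTerminal C := hT.hasTerminal
  have : HasPullbacks C := by
    have {X Y Z : C} {f : X ⟶ Z} {g : Y ⟶ Z} : HasLimit (cospan f g) := by
      obtain ⟨_, _, _, h, _⟩ := h₂ f g
      exact h.hasPullback
    exact hasPullbacks_of_hasLimit_cospan C
  have : PreservesLimitsOfShape WalkingCospan F :=
    preservesLimitsOfShape_walkingCospan_of_forall_isPullback fun _ _ _ f g _ ↦ h₂ f g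
  have : HasTerminal D := hFT.hasTerminal
  have : PreservesLimit (Functor.empty.{0} C) F :=
    preservesTerminal_of_iso F (F.mapIso (terminalIsTerminal.uniqueUpToIso hT) ≪≫
      hFT.uniqueUpToIso terminalIsTerminal)
  have := preservesLimitsOfShape_pempty_of_preservesTerminal F
  exact preservesFiniteLimits_of_preservesTerminal_and_pullbacks F

theorem IsRelation.map [HasFiniteLimits C] (F : C ⥤ D) [PreservesFiniteLimits F] {R X Y : C}
    {p : R ⟶ X} {q : R ⟶ Y} (h : IsRelation p q) : IsRelation (F.map p) (F.map q) := by
  -- `IsRelation` mentions no product. Here the product turns joint monicity into the monicity of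
  -- one map, which `F` preserves.
  have : Mono (prod.lift p q) := ⟨fun a b hab ↦ h a b
    (by simpa only [Category.assoc, prod.lift_fst] using hab =≫ prod.fst)
    (by simpa only [Category.assoc, prod.lift_snd] using hab =≫ prod.snd)⟩
  intro Z a b h₁ h₂
  have hP := (IsPullback.of_hasBinaryProduct' X Y).map F
  refine (cancel_mono (F.map (prod.lift p q))).1 (hP.hom_ext ?_ ?_)
  · simpa only [Category.assoc, ← F.map_comp, prod.lift_fst] using h₁
  · simpa only [Category.assoc, ← F.map_comp, prod.lift_snd] using h₂

theorem IsRegularFunctor.id : IsRegularFunctor (𝟭 C) := ⟨inferInstance, fun _ h ↦ h⟩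

theorem IsRegularFunctor.comp {F : C ⥤ D} {G : D ⥤ E} (hF : IsRegularFunctor F)
    (hG : IsRegularFunctor G) : IsRegularFunctor (F ⋙ G) where
  preservesFiniteLimits :=
    have := hF.preservesFiniteLimits
    have := hG.preservesFiniteLimits
    comp_preservesFiniteLimits F G
  map_cover f hf := hG.map_cover _ (hF.map_cover f hf)

theorem IsRegularFunctor.isPullback {F : C ⥤ D} (hF : IsRegularFunctor F) {W X Y Z : C}
    {p : W ⟶ X} {q : W ⟶ Y} {f : X ⟶ Z} {g : Y ⟶ Z} (h : IsPullback p q f g) :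
    IsPullback (F.map p) (F.map q) (F.map f) (F.map g) :=
  have := hF.preservesFiniteLimits
  h.map F

theorem IsRegularFunctor.mono {F : C ⥤ D} (hF : IsRegularFunctor F) {X Y : C} (f : X ⟶ Y)
    [Mono f] : Mono (F.map f) :=
  have := hF.preservesFiniteLimits
  inferInstance

theorem IsRegularFunctor.isTerminal {F : C ⥤ D} (hF : IsRegularFunctor F) {T : C}
    (hT : IsTerminal T) : Nonempty (IsTerminal (F.obj T)) :=
  have := hF.preservesFiniteLimits
  ⟨hT.isTerminalObj F T⟩

theorem IsRegularFunctor.isRelation {F : C ⥤ D} (hF : IsRegularFunctor F) (S : RegularStr C)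
    {R X Y : C} {p : R ⟶ X} {q : R ⟶ Y} (h : IsRelation p q) :
    IsRelation (F.map p) (F.map q) :=
  have := S.hasTerminal
  have := S.hasPullbacks
  have := hasFiniteLimits_of_hasTerminal_and_pullbacks (C := C)
  have := hF.preservesFiniteLimits
  h.map F

/-- A functor preserving enough finite limits and image factorisations is regular. -/
theorem IsRegularFunctor.of_exists {F : C ⥤ D}
    (h₁ : ∃ T : C, Nonempty (IsTerminal T) ∧ Nonempty (IsTerminal (F.obj T)))
    (h₂ : ∀ ⦃X Y Z : C⦄ (f : X ⟶ Z) (g : Y ⟶ Z), ∃ (P : C) (fst : P ⟶ X) (snd : P ⟶ Y),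
        IsPullback fst snd f g ∧ IsPullback (F.map fst) (F.map snd) (F.map f) (F.map g))
    (h₃ : ∀ ⦃X Y : C⦄ (f : X ⟶ Y), ∃ (I : C) (e : X ⟶ I) (m : I ⟶ Y), e ≫ m = f ∧ Mono m ∧
        IsCover (F.map e)) :
    IsRegularFunctor F where
  preservesFiniteLimits := preservesFiniteLimits_of_exists h₁ h₂
  map_cover f hf := by
    obtain ⟨I, e, m, rfl, _, he⟩ := h₃ f
    -- The image of a cover is everything, so `F f` is the cover `F e` followed by an isomorphism.
    have : IsIso m := hf m e rfl
    rw [F.map_comp]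
    exact he.comp_isIso _

theorem IsNNO.unique_iso {T N T' N' : C} {z : T ⟶ N} {s : N ⟶ N} {z' : T' ⟶ N'} {s' : N' ⟶ N'}
    (h : IsNNO z s) (h' : IsNNO z' s') :
    ∃ (t : T ≅ T') (n : N ≅ N'), z ≫ n.hom = t.hom ≫ z' ∧ s ≫ n.hom = n.hom ≫ s' := by
  obtain ⟨⟨hT⟩, h⟩ := h
  obtain ⟨⟨hT'⟩, h'⟩ := h'
  let t := hT.uniqueUpToIso hT'
  obtain ⟨a, ⟨ha₁, ha₂⟩, -⟩ := h (t.hom ≫ z') s'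
  obtain ⟨b, ⟨hb₁, hb₂⟩, -⟩ := h' (t.inv ≫ z) s
  refine ⟨t, ⟨a, b, ?_, ?_⟩, ha₁, ha₂⟩
  · refine (h z s).unique ⟨?_, ?_⟩ ⟨by simp, by simp⟩
    · simp [reassoc_of% ha₁, hb₁]
    · rw [reassoc_of% ha₂, hb₂, Category.assoc]
  · refine (h' z' s').unique ⟨?_, ?_⟩ ⟨by simp, by simp⟩
    · simp [reassoc_of% hb₁, ha₁]
    · rw [reassoc_of% hb₂, ha₂, Category.assoc]

theorem IsNNO.of_iso {T N T' N' : C} {z : T ⟶ N} {s : N ⟶ N} {z' : T' ⟶ N'} {s' : N' ⟶ N'}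
    (h : IsNNO z s) (t : T ≅ T') (n : N ≅ N') (hz : z ≫ n.hom = t.hom ≫ z')
    (hs : s ≫ n.hom = n.hom ≫ s') : IsNNO z' s' := by
  obtain ⟨⟨hT⟩, h⟩ := h
  refine ⟨⟨hT.ofIso t⟩, fun X a r ↦ ?_⟩
  obtain ⟨k, ⟨hk₁, hk₂⟩, hk⟩ := h (t.hom ≫ a) r
  have hz' : z' = t.inv ≫ z ≫ n.hom := by simp [hz]
  have hs' : s' = n.inv ≫ s ≫ n.hom := by simp [hs]
  refine ⟨n.inv ≫ k, ⟨by simp [hz', hk₁], by simp [hs', hk₂]⟩, fun l ⟨hl₁, hl₂⟩ ↦ ?_⟩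
  rw [← hk (n.hom ≫ l) ⟨by simp [reassoc_of% hz, hl₁], by simp [reassoc_of% hs, hl₂]⟩]
  simp

theorem Classifies.map {A P M B R : C} {memP : M ⟶ P} {memA : M ⟶ A} {r : R ⟶ B}
    {s : R ⟶ A} {χ : B ⟶ P} (h : Classifies memP memA r s χ) {F : C ⥤ D}
    (hF : IsRegularFunctor F) :
    Classifies (F.map memP) (F.map memA) (F.map r) (F.map s) (F.map χ) := by
  obtain ⟨k, hk, rfl⟩ := h
  exact ⟨F.map k, hF.isPullback hk, by simp⟩

theorem Classifies.of_iso {A P M B R A' P' M' : C} {memP : M ⟶ P} {memA : M ⟶ A} {r : R ⟶ B}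
    {s : R ⟶ A} {χ : B ⟶ P} (h : Classifies memP memA r s χ) {memP' : M' ⟶ P'}
    {memA' : M' ⟶ A'} (a : A ≅ A') (p : P ≅ P') (m : M ≅ M') (hp : memP ≫ p.hom = m.hom ≫ memP')
    (ha : memA ≫ a.hom = m.hom ≫ memA') :
    Classifies memP' memA' r (s ≫ a.hom) (χ ≫ p.hom) := by
  obtain ⟨k, hk, rfl⟩ := h
  exact ⟨k ≫ m.hom, hk.of_iso (Iso.refl _) m (Iso.refl _) p (by simp) (by simp) (by simp [hp])
    (by simp), by simp [ha]⟩

theorem IsRelation.of_iso {R X Y R' X' Y' : C} {p : R ⟶ X} {q : R ⟶ Y} (h : IsRelation p q)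
    {p' : R' ⟶ X'} {q' : R' ⟶ Y'} (r : R ≅ R') (x : X ≅ X') (y : Y ≅ Y')
    (hp : p ≫ x.hom = r.hom ≫ p') (hq : q ≫ y.hom = r.hom ≫ q') : IsRelation p' q' := by
  intro Z a b h₁ h₂
  have hp' : p' = r.inv ≫ p ≫ x.hom := by simp [hp]
  have hq' : q' = r.inv ≫ q ≫ y.hom := by simp [hq]
  rw [← cancel_mono r.inv]
  refine h _ _ ?_ ?_
  · rw [← cancel_mono x.hom]; simpa [hp'] using h₁
  · rw [← cancel_mono y.hom]; simpa [hq'] using h₂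

theorem IsPowerObject.of_iso {A P M A' P' M' : C} {memP : M ⟶ P} {memA : M ⟶ A}
    (h : IsPowerObject memP memA) {memP' : M' ⟶ P'} {memA' : M' ⟶ A'} (a : A ≅ A') (p : P ≅ P')
    (m : M ≅ M') (hp : memP ≫ p.hom = m.hom ≫ memP') (ha : memA ≫ a.hom = m.hom ≫ memA') :
    IsPowerObject memP' memA' := by
  refine ⟨h.1.of_iso m p a hp ha, fun B R r s hrs ↦ ?_⟩
  obtain ⟨χ, hχ, hu⟩ := h.2 r (s ≫ a.inv)
    (hrs.of_iso (Iso.refl _) (Iso.refl _) a.symm (by simp) (by simp))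
  refine ⟨χ ≫ p.hom, by simpa using hχ.of_iso a p m hp ha, fun χ' hχ' ↦ ?_⟩
  rw [← hu (χ' ≫ p.inv) (hχ'.of_iso a.symm p.symm m.symm ?_ ?_)]
  · simp
  · simp [Iso.eq_inv_comp, ← reassoc_of% hp]
  · simp [Iso.eq_inv_comp, ← reassoc_of% ha]

/-- Power-objects are unique up to a unique isomorphism. -/
theorem IsPowerObject.exists_iso {A P M A' P' M' : C} {memP : M ⟶ P} {memA : M ⟶ A}
    (h : IsPowerObject memP memA) {memP' : M' ⟶ P'} {memA' : M' ⟶ A'}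
    (h' : IsPowerObject memP' memA') (a : A ≅ A') :
    ∃ (p : P ≅ P') (m : M ≅ M'), memP ≫ p.hom = m.hom ≫ memP' ∧ memA ≫ a.hom = m.hom ≫ memA' := by
  -- The isomorphism `a` is absorbed into the membership relation, so that both are power-objects of
  -- `A'`.
  replace h := h.of_iso (memP' := memP) (memA' := memA ≫ a.hom) a (Iso.refl _) (Iso.refl _)
    (by simp) (by simp)
  generalize memA ≫ a.hom = memA at h
  -- The composite of the two classifying maps classifies the membership relation itself, as does
  -- the identity.
  have key {P M P' M' : C} {memP : M ⟶ P} {memA : M ⟶ A'} {memP' : M' ⟶ P'} {memA' : M' ⟶ A'}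
      (h : IsPowerObject memP memA) (h' : IsPowerObject memP' memA') {x : P ⟶ P'} {y : P' ⟶ P}
      (hx : Classifies memP' memA' memP memA x) (hy : Classifies memP memA memP' memA' y) :
      x ≫ y = 𝟙 P := by
    obtain ⟨k, hk, hk'⟩ := hx
    obtain ⟨l, hl, hl'⟩ := hy
    exact (h.2 memP _ h.1).unique ⟨k ≫ l, hk.paste_horiz hl, by simp [hl', hk']⟩ ⟨𝟙 _, .of_id_fst, by simp⟩
  obtain ⟨x, hx, -⟩ := h'.2 _ _ h.1
  obtain ⟨y, hy, -⟩ := h.2 _ _ h'.1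
  let p : P ≅ P' := ⟨x, y, key h h' hx hy, key h' h hy hx⟩
  obtain ⟨k, hk, hkA⟩ := hx
  have : IsIso x := p.isIso_hom
  have : IsIso k := hk.isIso_fst_of_isIso
  exact ⟨p, asIso k, hk.w.symm, hkA.symm⟩

end Functors

/-! ### Selected cones and factorisations -/

section Selection

variable {C : Type u₁} [Category.{v₁} C]

/-- `(p, q)` is the chosen pullback of `(f, g)`. -/
inductive RegularStr.SelPb (S : RegularStr C) {X Y Z : C} (f : X ⟶ Z) (g : Y ⟶ Z) :
    ∀ {W : C}, (W ⟶ X) → (W ⟶ Y) → Prop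
  | mk : S.SelPb f g (S.pbFst f g) (S.pbSnd f g)

/-- `(e, m)` is the chosen image factorisation of `f`. -/
inductive RegularStr.SelIm (S : RegularStr C) {X Y : C} (f : X ⟶ Y) :
    ∀ {I : C}, (X ⟶ I) → (I ⟶ Y) → Prop
  | mk : S.SelIm f (S.imCover f) (S.imMono f)

/-- Strictness is stated by equalities of arrows, whereas case analysis on `SelPb` replaces a cone
by the chosen one. This passes between the two. -/
theorem RegularStr.selPb_iff {S : RegularStr C} {W X Y Z : C} {f : X ⟶ Z} {g : Y ⟶ Z}
    {p : W ⟶ X} {q : W ⟶ Y} : S.SelPb f g p q ↔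
      Arrow.mk p = Arrow.mk (S.pbFst f g) ∧ Arrow.mk q = Arrow.mk (S.pbSnd f g) := by
  constructor
  · rintro ⟨⟩
    exact ⟨rfl, rfl⟩
  · rintro ⟨hp, hq⟩
    obtain rfl : W = S.pb f g := congrArg Comma.left hp
    obtain rfl := (Arrow.mk_inj _ _).1 hp
    obtain rfl := (Arrow.mk_inj _ _).1 hq
    exact .mk

theorem RegularStr.selIm_iff {S : RegularStr C} {X Y I : C} {f : X ⟶ Y} {e : X ⟶ I} {m : I ⟶ Y} :
    S.SelIm f e m ↔
      Arrow.mk e = Arrow.mk (S.imCover f) ∧ Arrow.mk m = Arrow.mk (S.imMono f) := by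
  constructor
  · rintro ⟨⟩
    exact ⟨rfl, rfl⟩
  · rintro ⟨he, hm⟩
    obtain rfl : I = S.im f := congrArg Comma.left hm
    obtain rfl := (Arrow.mk_inj _ _).1 he
    obtain rfl := (Arrow.mk_inj _ _).1 hm
    exact .mk

theorem RegularStr.SelPb.isPullback {S : RegularStr C} {W X Y Z : C} {f : X ⟶ Z} {g : Y ⟶ Z}
    {p : W ⟶ X} {q : W ⟶ Y} (h : S.SelPb f g p q) : IsPullback p q f g := by
  cases h
  exact S.isPullback f g

theorem RegularStr.SelIm.fac {S : RegularStr C} {X Y I : C} {f : X ⟶ Y} {e : X ⟶ I} {m : I ⟶ Y}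
    (h : S.SelIm f e m) : e ≫ m = f := by
  cases h
  exact S.im_fac f

theorem RegularStr.SelIm.isCover {S : RegularStr C} {X Y I : C} {f : X ⟶ Y} {e : X ⟶ I} {m : I ⟶ Y}
    (h : S.SelIm f e m) : IsCover e := by
  cases h
  exact S.isCover_imCover f

theorem RegularStr.SelIm.mono {S : RegularStr C} {X Y I : C} {f : X ⟶ Y} {e : X ⟶ I} {m : I ⟶ Y}
    (h : S.SelIm f e m) : Mono m := by
  cases h
  exact S.mono_imMono f

namespace RankedToposStr

variable (S : RankedToposStr C)

/-- The objects of rank `i`, for `k = some i`; all objects, for `k = none`. -/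
def InRank : Option ℕ → ObjectProperty C
  | none => fun _ ↦ True
  | some i => S.rank i

/-- `W` is the terminal object chosen in `C` or in one of the ranks. -/
def SelOne : Option ℕ → C → Prop
  | none, W => W = S.reg.one
  | some i, W => W = (S.rankReg i).one.obj

/-- `(p, q)` is the pullback of `(f, g)` chosen in `C` or in one of the ranks. -/
def SelPb {W X Y Z : C} (f : X ⟶ Z) (g : Y ⟶ Z) (p : W ⟶ X) (q : W ⟶ Y) : Option ℕ → Prop
  | none => S.reg.SelPb f g p q
  | some i => ∃ (hX : S.rank i X) (hY : S.rank i Y) (hZ : S.rank i Z) (hW : S.rank i W),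
      (S.rankReg i).SelPb (X := ⟨X, hX⟩) (Y := ⟨Y, hY⟩) (Z := ⟨Z, hZ⟩) (W := ⟨W, hW⟩)
        ⟨f⟩ ⟨g⟩ ⟨p⟩ ⟨q⟩

/-- `(e, m)` is the image factorisation of `f` chosen in `C` or in one of the ranks. -/
def SelIm {X Y I : C} (f : X ⟶ Y) (e : X ⟶ I) (m : I ⟶ Y) : Option ℕ → Prop
  | none => S.reg.SelIm f e m
  | some i => ∃ (hX : S.rank i X) (hY : S.rank i Y) (hI : S.rank i I),
      (S.rankReg i).SelIm (X := ⟨X, hX⟩) (Y := ⟨Y, hY⟩) (I := ⟨I, hI⟩) ⟨f⟩ ⟨e⟩ ⟨m⟩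

variable {S} {k : Option ℕ}

theorem exists_selOne (k : Option ℕ) : ∃ W, S.SelOne k W := by
  cases k <;> exact ⟨_, rfl⟩

theorem exists_selPb (k : Option ℕ) {X Y Z : C} (f : X ⟶ Z) (g : Y ⟶ Z) (hX : S.InRank k X)
    (hY : S.InRank k Y) (hZ : S.InRank k Z) :
    ∃ (W : C) (p : W ⟶ X) (q : W ⟶ Y), S.SelPb f g p q k := by
  cases k with
  | none => exact ⟨_, _, _, .mk⟩
  | some i => exact ⟨_, _, _, hX, hY, hZ, ((S.rankReg i).pb _ _).property, .mk⟩

theorem exists_selIm (k : Option ℕ) {X Y : C} (f : X ⟶ Y) (hX : S.InRank k X)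
    (hY : S.InRank k Y) : ∃ (I : C) (e : X ⟶ I) (m : I ⟶ Y), S.SelIm f e m k := by
  cases k with
  | none => exact ⟨_, _, _, .mk⟩
  | some i => exact ⟨_, _, _, hX, hY, ((S.rankReg i).im _).property, .mk⟩

theorem SelOne.inRank {W : C} (h : S.SelOne k W) : S.InRank k W := by
  cases k with
  | none => trivial
  | some i =>
    obtain rfl : W = _ := h
    exact (S.rankReg i).one.property

theorem SelPb.inRank {W X Y Z : C} {f : X ⟶ Z} {g : Y ⟶ Z} {p : W ⟶ X} {q : W ⟶ Y}
    (h : S.SelPb f g p q k) : S.InRank k W := by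
  cases k with
  | none => trivial
  | some i => exact h.choose_spec.choose_spec.choose_spec.choose

theorem SelIm.inRank {X Y I : C} {f : X ⟶ Y} {e : X ⟶ I} {m : I ⟶ Y}
    (h : S.SelIm f e m k) : S.InRank k I := by
  cases k with
  | none => trivial
  | some i => exact h.choose_spec.choose_spec.choose

theorem SelOne.isTerminal {W : C} (h : S.SelOne k W) : Nonempty (IsTerminal W) := by
  cases k with
  | none =>
    obtain rfl : W = _ := h
    exact ⟨S.reg.isTerminal⟩
  | some i =>
    obtain rfl : W = _ := h
    exact (S.rank_regular i).isTerminal (S.rankReg i).isTerminal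

theorem SelPb.isPullback {W X Y Z : C} {f : X ⟶ Z} {g : Y ⟶ Z} {p : W ⟶ X} {q : W ⟶ Y}
    (h : S.SelPb f g p q k) : IsPullback p q f g := by
  cases k with
  | none => exact RegularStr.SelPb.isPullback h
  | some i =>
    obtain ⟨_, _, _, _, h⟩ := h
    exact (S.rank_regular i).isPullback h.isPullback

theorem SelIm.fac {X Y I : C} {f : X ⟶ Y} {e : X ⟶ I} {m : I ⟶ Y}
    (h : S.SelIm f e m k) : e ≫ m = f := by
  cases k with
  | none => exact RegularStr.SelIm.fac h
  | some i =>
    obtain ⟨_, _, _, h⟩ := h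
    exact congrArg InducedCategory.Hom.hom h.fac

theorem SelIm.mono {X Y I : C} {f : X ⟶ Y} {e : X ⟶ I} {m : I ⟶ Y}
    (h : S.SelIm f e m k) : Mono m := by
  cases k with
  | none => exact RegularStr.SelIm.mono h
  | some i =>
    obtain ⟨_, _, _, h⟩ := h
    exact @IsRegularFunctor.mono _ _ _ _ _ (S.rank_regular i) _ _ _ h.mono

theorem SelIm.isCover {X Y I : C} {f : X ⟶ Y} {e : X ⟶ I} {m : I ⟶ Y}
    (h : S.SelIm f e m k) : IsCover e := by
  cases k with
  | none => exact RegularStr.SelIm.isCover h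
  | some i =>
    obtain ⟨_, _, _, h⟩ := h
    exact (S.rank_regular i).map_cover _ h.isCover

theorem SelOne.unique {W W' : C} (h : S.SelOne k W) (h' : S.SelOne k W') : W = W' := by
  cases k <;> exact Eq.trans h (Eq.symm h')

/-- The two cospans may live on objects that are equal only propositionally, as happens for the
images under two functors; hence equality in the arrow category. -/
theorem SelPb.unique {W X Y Z W' X' Y' Z' : C} {f : X ⟶ Z} {g : Y ⟶ Z} {p : W ⟶ X} {q : W ⟶ Y}
    {f' : X' ⟶ Z'} {g' : Y' ⟶ Z'} {p' : W' ⟶ X'} {q' : W' ⟶ Y'}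
    (h : S.SelPb f g p q k) (h' : S.SelPb f' g' p' q' k) (hf : Arrow.mk f = Arrow.mk f')
    (hg : Arrow.mk g = Arrow.mk g') :
    Arrow.mk p = Arrow.mk p' ∧ Arrow.mk q = Arrow.mk q' := by
  obtain rfl : X = X' := congrArg Comma.left hf
  obtain rfl : Y = Y' := congrArg Comma.left hg
  obtain rfl : Z = Z' := congrArg Comma.right hf
  obtain rfl := (Arrow.mk_inj _ _).1 hf
  obtain rfl := (Arrow.mk_inj _ _).1 hg
  cases k with
  | none =>
    rw [SelPb, RegularStr.selPb_iff] at h h'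
    exact ⟨h.1.trans h'.1.symm, h.2.trans h'.2.symm⟩
  | some i =>
    obtain ⟨_, _, _, _, h⟩ := h
    obtain ⟨_, _, _, _, h'⟩ := h'
    rw [RegularStr.selPb_iff] at h h'
    exact ⟨congrArg (S.rank i).ι.mapArrow.obj (h.1.trans h'.1.symm),
      congrArg (S.rank i).ι.mapArrow.obj (h.2.trans h'.2.symm)⟩

theorem SelIm.unique {X Y I X' Y' I' : C} {f : X ⟶ Y} {e : X ⟶ I} {m : I ⟶ Y}
    {f' : X' ⟶ Y'} {e' : X' ⟶ I'} {m' : I' ⟶ Y'}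
    (h : S.SelIm f e m k) (h' : S.SelIm f' e' m' k) (hf : Arrow.mk f = Arrow.mk f') :
    Arrow.mk e = Arrow.mk e' ∧ Arrow.mk m = Arrow.mk m' := by
  obtain rfl : X = X' := congrArg Comma.left hf
  obtain rfl : Y = Y' := congrArg Comma.right hf
  obtain rfl := (Arrow.mk_inj _ _).1 hf
  cases k with
  | none =>
    rw [SelIm, RegularStr.selIm_iff] at h h'
    exact ⟨h.1.trans h'.1.symm, h.2.trans h'.2.symm⟩
  | some i =>
    obtain ⟨_, _, _, h⟩ := h
    obtain ⟨_, _, _, h'⟩ := h'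
    rw [RegularStr.selIm_iff] at h h'
    exact ⟨congrArg (S.rank i).ι.mapArrow.obj (h.1.trans h'.1.symm),
      congrArg (S.rank i).ι.mapArrow.obj (h.2.trans h'.2.symm)⟩

end RankedToposStr

end Selection

/-! ### Strict functors in terms of selected cones and factorisations. -/

section Strict

variable {C : Type u₁} [Category.{v₁} C] {D : Type u₂} [Category.{v₂} D]

theorem isStrictRegular_iff {S : RegularStr C} {S' : RegularStr D} {F : C ⥤ D} :
    IsStrictRegular S S' F ↔ F.obj S.one = S'.one ∧
      (∀ {X Y Z : C} (f : X ⟶ Z) (g : Y ⟶ Z),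
        S'.SelPb (F.map f) (F.map g) (F.map (S.pbFst f g)) (F.map (S.pbSnd f g))) ∧
      ∀ {X Y : C} (f : X ⟶ Y), S'.SelIm (F.map f) (F.map (S.imCover f)) (F.map (S.imMono f)) where
  mp h := ⟨h.one, fun f g ↦ RegularStr.selPb_iff.2 ⟨h.pbFst f g, h.pbSnd f g⟩,
    fun f ↦ RegularStr.selIm_iff.2 ⟨h.imCover f, h.imMono f⟩⟩
  mpr h := ⟨h.1, fun f g ↦ (RegularStr.selPb_iff.1 (h.2.1 f g)).1,
    fun f g ↦ (RegularStr.selPb_iff.1 (h.2.1 f g)).2, fun f ↦ (RegularStr.selIm_iff.1 (h.2.2 f)).1,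
    fun f ↦ (RegularStr.selIm_iff.1 (h.2.2 f)).2⟩

theorem IsStrictRegular.selPb {S : RegularStr C} {S' : RegularStr D} {F : C ⥤ D}
    (hF : IsStrictRegular S S' F) {W X Y Z : C} {f : X ⟶ Z} {g : Y ⟶ Z} {p : W ⟶ X} {q : W ⟶ Y}
    (h : S.SelPb f g p q) : S'.SelPb (F.map f) (F.map g) (F.map p) (F.map q) := by
  cases h
  exact (isStrictRegular_iff.1 hF).2.1 f g

theorem IsStrictRegular.selIm {S : RegularStr C} {S' : RegularStr D} {F : C ⥤ D}
    (hF : IsStrictRegular S S' F) {X Y I : C} {f : X ⟶ Y} {e : X ⟶ I} {m : I ⟶ Y}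
    (h : S.SelIm f e m) : S'.SelIm (F.map f) (F.map e) (F.map m) := by
  cases h
  exact (isStrictRegular_iff.1 hF).2.2 f

theorem IsStrictRegular.isRegularFunctor {S : RegularStr C} {S' : RegularStr D} {F : C ⥤ D}
    (hF : IsStrictRegular S S' F) : IsRegularFunctor F := by
  refine .of_exists ⟨S.one, ⟨S.isTerminal⟩, ?_⟩ (fun X Y Z f g ↦ ?_) fun X Y f ↦ ?_
  · rw [hF.one]
    exact ⟨S'.isTerminal⟩
  · exact ⟨_, _, _, S.isPullback f g, (hF.selPb .mk).isPullback⟩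
  · refine ⟨_, _, _, S.im_fac f, S.mono_imMono f, ?_⟩
    have h := hF.selIm (.mk (f := f))
    revert h
    -- With the image data replaced by variables, case analysis on the selection can identify them
    -- with the factorisation chosen in the target.
    generalize F.map (S.imCover f) = e
    generalize F.map (S.imMono f) = m
    generalize F.obj (S.im f) = I at *
    rintro ⟨⟩
    exact S'.isCover_imCover _

variable {S : RankedToposStr C} {S' : RankedToposStr D} {F : C ⥤ D} {k : Option ℕ}

theorem IsStrictRankedLogical.selOne (hF : IsStrictRankedLogical S S' F) {W : C}
    (h : S.SelOne k W) : S'.SelOne k (F.obj W) := by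
  cases k with
  | none =>
    obtain rfl : W = _ := h
    exact hF.reg.one
  | some i =>
    obtain rfl : W = _ := h
    exact congrArg ObjectProperty.FullSubcategory.obj (hF.rankReg i).one

theorem IsStrictRankedLogical.selPb (hF : IsStrictRankedLogical S S' F) {W X Y Z : C} {f : X ⟶ Z}
    {g : Y ⟶ Z} {p : W ⟶ X} {q : W ⟶ Y} (h : S.SelPb f g p q k) :
    S'.SelPb (F.map f) (F.map g) (F.map p) (F.map q) k := by
  cases k with
  | none => exact hF.reg.selPb h
  | some i =>
    obtain ⟨hX, hY, hZ, hW, h⟩ := h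
    exact ⟨hF.rank i _ hX, hF.rank i _ hY, hF.rank i _ hZ, hF.rank i _ hW, (hF.rankReg i).selPb h⟩

theorem IsStrictRankedLogical.selIm (hF : IsStrictRankedLogical S S' F) {X Y I : C} {f : X ⟶ Y}
    {e : X ⟶ I} {m : I ⟶ Y} (h : S.SelIm f e m k) :
    S'.SelIm (F.map f) (F.map e) (F.map m) k := by
  cases k with
  | none => exact hF.reg.selIm h
  | some i =>
    obtain ⟨hX, hY, hI, h⟩ := h
    exact ⟨hF.rank i _ hX, hF.rank i _ hY, hF.rank i _ hI, (hF.rankReg i).selIm h⟩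

end Strict

/-! ### Joint creation of structure -/

section Creation

variable {J : Type u} {C : J → Type u₁} [∀ j, Category.{v₁} (C j)] {P : Type u₂} [Category.{v₂} P]

/-- The chosen regular structure of each `C j` lifts to `P` along the functors `U j`. -/
structure JointlyCreatesReg (U : ∀ j, P ⥤ C j) (S : ∀ j, RegularStr (C j)) : Prop where
  faithful : ∀ {X Y : P} (f g : X ⟶ Y), (∀ j, (U j).map f = (U j).map g) → f = g
  conservative : ∀ {X Y : P} (f : X ⟶ Y), (∀ j, IsIso ((U j).map f)) → IsIso f
  one : ∃ W : P, Nonempty (IsTerminal W) ∧ ∀ j, (U j).obj W = (S j).one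
  pb : ∀ {X Y Z : P} (f : X ⟶ Z) (g : Y ⟶ Z), ∃ (W : P) (p : W ⟶ X) (q : W ⟶ Y),
    IsPullback p q f g ∧
      ∀ j, (S j).SelPb ((U j).map f) ((U j).map g) ((U j).map p) ((U j).map q)
  im : ∀ {X Y : P} (f : X ⟶ Y), ∃ (I : P) (e : X ⟶ I) (m : I ⟶ Y),
    e ≫ m = f ∧ ∀ j, (S j).SelIm ((U j).map f) ((U j).map e) ((U j).map m)

namespace JointlyCreatesReg

variable {U : ∀ j, P ⥤ C j} {S : ∀ j, RegularStr (C j)}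

theorem mono (h : JointlyCreatesReg U S) {X Y : P} {m : X ⟶ Y} (hm : ∀ j, Mono ((U j).map m)) :
    Mono m :=
  ⟨fun a b hab ↦ h.faithful a b fun j ↦ (cancel_mono ((U j).map m)).1 (by
    rw [← (U j).map_comp, ← (U j).map_comp, hab])⟩

theorem isRegularFunctor (h : JointlyCreatesReg U S) (j : J) : IsRegularFunctor (U j) := by
  refine .of_exists ?_ (fun X Y Z f g ↦ ?_) fun X Y f ↦ ?_
  · obtain ⟨W, hW, hW'⟩ := h.one
    exact ⟨W, hW, (hW' j).symm ▸ ⟨(S j).isTerminal⟩⟩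
  · obtain ⟨W, p, q, hpq, hpq'⟩ := h.pb f g
    exact ⟨W, p, q, hpq, (hpq' j).isPullback⟩
  · obtain ⟨I, e, m, hem, hem'⟩ := h.im f
    exact ⟨I, e, m, hem, h.mono fun j ↦ (hem' j).mono, (hem' j).isCover⟩

theorem isCover (h : JointlyCreatesReg U S) {X Y : P} {f : X ⟶ Y}
    (hf : ∀ j, IsCover ((U j).map f)) : IsCover f := by
  intro I m _ g hg
  refine h.conservative m fun j ↦ ?_
  have := (h.isRegularFunctor j).mono m
  exact hf j _ ((U j).map g) (by rw [← (U j).map_comp, hg])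

/-- The comparison with the pullback lifted to `P` is inverted by every `U j`, hence invertible. -/
theorem isPullback (h : JointlyCreatesReg U S) {W X Y Z : P} {p : W ⟶ X} {q : W ⟶ Y} {f : X ⟶ Z}
    {g : Y ⟶ Z} (w : p ≫ f = q ≫ g)
    (H : ∀ j, IsPullback ((U j).map p) ((U j).map q) ((U j).map f) ((U j).map g)) :
    IsPullback p q f g := by
  obtain ⟨W', p', q', hpq, -⟩ := h.pb f g
  have : IsIso (hpq.lift p q w) := by
    refine h.conservative _ fun j ↦ ?_
    have H' := (h.isRegularFunctor j).isPullback hpq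
    have : (U j).map (hpq.lift p q w) = ((H j).isoIsPullback _ _ H').hom :=
      H'.hom_ext (by rw [IsPullback.isoIsPullback_hom_fst, ← Functor.map_comp, hpq.lift_fst])
        (by rw [IsPullback.isoIsPullback_hom_snd, ← Functor.map_comp, hpq.lift_snd])
    rw [this]
    infer_instance
  exact hpq.of_iso (asIso (hpq.lift p q w)).symm (Iso.refl _) (Iso.refl _) (Iso.refl _)
    (by simp) (by simp) (by simp) (by simp)

theorem exists_regularStr (h : JointlyCreatesReg U S) :
    ∃ S' : RegularStr P, ∀ j, IsStrictRegular S' (S j) (U j) := by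
  obtain ⟨W, ⟨hW⟩, hW'⟩ := h.one
  choose pb p q hpq hpq' using @h.pb
  choose im e m hem hem' using @h.im
  refine ⟨{ one := W
            isTerminal := hW
            pb := pb
            pbFst := p
            pbSnd := q
            isPullback := hpq
            im := im
            imCover := e
            imMono := m
            im_fac := hem
            isCover_imCover f := h.isCover fun j ↦ (hem' f j).isCover
            mono_imMono f := h.mono fun j ↦ (hem' f j).mono
            cover_stable hP hg := h.isCover fun j ↦ (S j).cover_stable
              ((h.isRegularFunctor j).isPullback hP) ((h.isRegularFunctor j).map_cover _ hg) },
    fun j ↦ isStrictRegular_iff.2 ⟨hW' j, fun f g ↦ hpq' f g j, fun f ↦ hem' f j⟩⟩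

/-- Uniqueness of the recursor is detected by the `U j`. As these need not be jointly full, `hrec`
must supply a map of `P` lying over the recursors in the `C j`. In `isPowerObject`, `hM` and `hχ`
play the same role. -/
theorem isNNO (h : JointlyCreatesReg U S) {T N : P} {z : T ⟶ N} {s : N ⟶ N} (hT : IsTerminal T)
    (H : ∀ j, IsNNO ((U j).map z) ((U j).map s))
    (hrec : ∀ {X : P} (a : T ⟶ X) (t : X ⟶ X) (l : ∀ j, (U j).obj N ⟶ (U j).obj X),
      (∀ j, (U j).map z ≫ l j = (U j).map a ∧ (U j).map s ≫ l j = l j ≫ (U j).map t) →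
        ∃ l' : N ⟶ X, ∀ j, (U j).map l' = l j) : IsNNO z s := by
  refine ⟨⟨hT⟩, fun X a t ↦ ?_⟩
  choose l hl hl' using fun j ↦ (H j).2 ((U j).map a) ((U j).map t)
  obtain ⟨l', hl₁⟩ := hrec a t l hl
  refine ⟨l', ⟨h.faithful _ _ fun j ↦ ?_, h.faithful _ _ fun j ↦ ?_⟩, fun k hk ↦
    h.faithful _ _ fun j ↦ ?_⟩
  · simp [hl₁, (hl j).1]
  · simp [hl₁, (hl j).2]
  · rw [hl₁]
    exact hl' j _ ⟨by rw [← Functor.map_comp, hk.1],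
      by rw [← Functor.map_comp, ← Functor.map_comp, hk.2]⟩

theorem isPowerObject (h : JointlyCreatesReg U S) {A Q M : P} {memP : M ⟶ Q} {memA : M ⟶ A}
    (H : ∀ j, IsPowerObject ((U j).map memP) ((U j).map memA))
    (hM : ∀ {Z : P} (x : Z ⟶ Q) (y : Z ⟶ A) (l : ∀ j, (U j).obj Z ⟶ (U j).obj M),
      (∀ j, l j ≫ (U j).map memP = (U j).map x ∧ l j ≫ (U j).map memA = (U j).map y) →
        ∃ l' : Z ⟶ M, ∀ j, (U j).map l' = l j)
    (hχ : ∀ {B R : P} (r : R ⟶ B) (s : R ⟶ A) (χ : ∀ j, (U j).obj B ⟶ (U j).obj Q),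
      (∀ j, Classifies ((U j).map memP) ((U j).map memA) ((U j).map r) ((U j).map s) (χ j)) →
        ∃ χ' : B ⟶ Q, ∀ j, (U j).map χ' = χ j) : IsPowerObject memP memA := by
  obtain ⟨S', -⟩ := h.exists_regularStr
  have hmem : IsRelation memP memA := fun Z a b h₁ h₂ ↦ h.faithful _ _ fun j ↦ (H j).1 _ _
    (by rw [← Functor.map_comp, ← Functor.map_comp, h₁])
    (by rw [← Functor.map_comp, ← Functor.map_comp, h₂])
  refine ⟨hmem, fun B R r s hrs ↦ ?_⟩
  choose χ hχ₁ hχ₂ using fun j ↦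
    (H j).2 ((U j).map r) ((U j).map s) ((h.isRegularFunctor j).isRelation S' hrs)
  obtain ⟨χ', hχ'⟩ := hχ r s χ hχ₁
  choose k hk hks using hχ₁
  obtain ⟨k', hk'⟩ := hM (r ≫ χ') s k fun j ↦ ⟨by simp [(hk j).w, hχ'], hks j⟩
  refine ⟨χ', ⟨k', h.isPullback (h.faithful _ _ fun j ↦ ?_) fun j ↦ ?_,
    h.faithful _ _ fun j ↦ ?_⟩, fun χ'' h' ↦ h.faithful _ _ fun j ↦ ?_⟩
  · simp [hk', hχ', (hk j).w]
  · simpa [hk', hχ'] using hk j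
  · simp [hk', hks]
  · rw [hχ']
    exact hχ₂ j _ (h'.map (h.isRegularFunctor j))

end JointlyCreatesReg

/-- The chosen regular structure of each `C j`, and of its ranks, lifts to `P` along the functors
`U j`. -/
structure JointlyCreatesRegs (U : ∀ j, P ⥤ C j) (S : ∀ j, RankedToposStr (C j)) : Prop where
  faithful : ∀ {X Y : P} (f g : X ⟶ Y), (∀ j, (U j).map f = (U j).map g) → f = g
  conservative : ∀ {X Y : P} (f : X ⟶ Y), (∀ j, IsIso ((U j).map f)) → IsIso f
  one : ∀ k, ∃ W : P, Nonempty (IsTerminal W) ∧ ∀ j, (S j).SelOne k ((U j).obj W)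
  pb : ∀ k {X Y Z : P} (f : X ⟶ Z) (g : Y ⟶ Z), (∀ j, (S j).InRank k ((U j).obj X)) →
    (∀ j, (S j).InRank k ((U j).obj Y)) → (∀ j, (S j).InRank k ((U j).obj Z)) →
    ∃ (W : P) (p : W ⟶ X) (q : W ⟶ Y), IsPullback p q f g ∧
      ∀ j, (S j).SelPb ((U j).map f) ((U j).map g) ((U j).map p) ((U j).map q) k
  im : ∀ k {X Y : P} (f : X ⟶ Y), (∀ j, (S j).InRank k ((U j).obj X)) →
    (∀ j, (S j).InRank k ((U j).obj Y)) →
    ∃ (I : P) (e : X ⟶ I) (m : I ⟶ Y), e ≫ m = f ∧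
      ∀ j, (S j).SelIm ((U j).map f) ((U j).map e) ((U j).map m) k

/-- The chosen structure of each `C j` lifts to `P` along the functors `U j`. -/
structure JointlyCreates (U : ∀ j, P ⥤ C j) (S : ∀ j, RankedToposStr (C j)) : Prop extends
    JointlyCreatesRegs U S where
  nno : ∀ T : P, IsTerminal T → (∀ j, (U j).obj T = (S j).reg.one) →
    ∃ (N : P) (z : T ⟶ N) (s : N ⟶ N), IsNNO z s ∧
      ∀ j, Arrow.mk ((U j).map z) = Arrow.mk (S j).nno.zero ∧
        Arrow.mk ((U j).map s) = Arrow.mk (S j).nno.succ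
  power : ∀ i (A : P), (∀ j, (S j).rank i ((U j).obj A)) → ∃ Q : PowerObject A,
    ∀ j (h : (S j).rank i ((U j).obj A)), IsStrictPower (U j) Q ((S j).power i _ h)

theorem JointlyCreatesRegs.reg {U : ∀ j, P ⥤ C j} {S : ∀ j, RankedToposStr (C j)}
    (h : JointlyCreatesRegs U S) : JointlyCreatesReg U (fun j ↦ (S j).reg) where
  faithful := h.faithful
  conservative := h.conservative
  one := h.one none
  pb f g := h.pb none f g (fun _ ↦ trivial) (fun _ ↦ trivial) (fun _ ↦ trivial)
  im f := h.im none f (fun _ ↦ trivial) (fun _ ↦ trivial)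

namespace JointlyCreates

variable {U : ∀ j, P ⥤ C j} {S : ∀ j, RankedToposStr (C j)}

/-- The objects of `P` all of whose images have rank `i`. -/
def rank (U : ∀ j, P ⥤ C j) (S : ∀ j, RankedToposStr (C j)) (i : ℕ) : ObjectProperty P :=
  fun X ↦ ∀ j, (S j).rank i ((U j).obj X)

theorem rankReg (h : JointlyCreates U S) (i : ℕ) :
    JointlyCreatesReg
      (fun j ↦ restrict (P := rank U S i) (Q := (S j).rank i) (U j) fun _ h ↦ h j)
      (fun j ↦ (S j).rankReg i) where
  faithful f g hfg := ObjectProperty.hom_ext _ (h.faithful _ _ fun j ↦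
    congrArg ((S j).rank i).ι.map (hfg j))
  conservative f hf := by
    rw [← ObjectProperty.isIso_hom_iff]
    exact h.conservative _ fun j ↦ (ObjectProperty.isIso_hom_iff _).2 (hf j)
  one := by
    obtain ⟨W, ⟨hW⟩, hW'⟩ := h.one (some i)
    exact ⟨⟨W, fun j ↦ (hW' j).inRank⟩,
      ⟨IsTerminal.ofUniqueHom (fun X ↦ ⟨hW.from X.obj⟩)
        fun X f ↦ ObjectProperty.hom_ext _ (hW.hom_ext _ _)⟩,
      fun j ↦ ObjectProperty.FullSubcategory.ext (hW' j)⟩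
  pb {X Y Z} f g := by
    obtain ⟨W, p, q, hpq, hpq'⟩ := h.pb (some i) f.hom g.hom X.property Y.property Z.property
    refine ⟨⟨W, fun j ↦ (hpq' j).inRank⟩, ⟨p⟩, ⟨q⟩,
      IsPullback.of_map_of_faithful (rank U S i).ι hpq, fun j ↦ ?_⟩
    obtain ⟨_, _, _, _, H⟩ := hpq' j
    exact H
  im {X Y} f := by
    obtain ⟨I, e, m, hem, hem'⟩ := h.im (some i) f.hom X.property Y.property
    refine ⟨⟨I, fun j ↦ (hem' j).inRank⟩, ⟨e⟩, ⟨m⟩, ObjectProperty.hom_ext _ hem, fun j ↦ ?_⟩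
    obtain ⟨_, _, _, H⟩ := hem' j
    exact H

theorem rank_regular (h : JointlyCreates U S) (i : ℕ) : IsRegularFunctor (rank U S i).ι := by
  refine .of_exists ?_ (fun X Y Z f g ↦ ?_) fun X Y f ↦ ?_
  · obtain ⟨W, ⟨hW⟩, hW'⟩ := h.one (some i)
    exact ⟨⟨W, fun j ↦ (hW' j).inRank⟩,
      ⟨IsTerminal.ofUniqueHom (fun X ↦ ⟨hW.from X.obj⟩)
        fun X f ↦ ObjectProperty.hom_ext _ (hW.hom_ext _ _)⟩, ⟨hW⟩⟩
  · obtain ⟨W, p, q, hpq, hpq'⟩ := h.pb (some i) f.hom g.hom X.property Y.property Z.property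
    exact ⟨⟨W, fun j ↦ (hpq' j).inRank⟩, ⟨p⟩, ⟨q⟩,
      IsPullback.of_map_of_faithful (rank U S i).ι hpq, hpq⟩
  · obtain ⟨I, e, m, hem, hem'⟩ := h.im (some i) f.hom X.property Y.property
    have : Mono m := h.reg.mono fun j ↦ (hem' j).mono
    exact ⟨⟨I, fun j ↦ (hem' j).inRank⟩, ⟨e⟩, ⟨m⟩, ObjectProperty.hom_ext _ hem,
      ⟨fun a b hab ↦ ObjectProperty.hom_ext _ ((cancel_mono m).1
        (congrArg InducedCategory.Hom.hom hab))⟩, h.reg.isCover fun j ↦ (hem' j).isCover⟩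

/-- The common construction behind products, closed classes of maps and triples `(X, Y, F X ≅ G Y)`.
The description of the ranks ensures that, when all objects of every `C j` have rank `0`, so do
those of `P`; this covers toposes as well. -/
theorem exists_rankedToposStr (h : JointlyCreates U S) :
    ∃ S' : RankedToposStr P, (∀ j, IsStrictRankedLogical S' (S j) (U j)) ∧
      ∀ i X, S'.rank i X ↔ ∀ j, (S j).rank i ((U j).obj X) := by
  obtain ⟨R, hR⟩ := h.reg.exists_regularStr
  choose R' hR' using fun i ↦ (h.rankReg i).exists_regularStr
  obtain ⟨N, z, s, hN, hN'⟩ := h.nno R.one R.isTerminal fun j ↦ (hR j).one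
  choose Q hQ using h.power
  exact ⟨{ reg := R
           nno := ⟨N, z, s, hN⟩
           rank := rank U S
           rank_mono := fun i X hX j ↦ (S j).rank_mono i _ (hX j)
           rankReg := R'
           rank_regular := h.rank_regular
           nat_mem := fun i j ↦ by
            have : (U j).obj N = (S j).nno.nat := congrArg Comma.right (hN' j).1
            rw [this]
            exact (S j).nat_mem i
           power := Q
           power_mem := fun i A hA j ↦ by
            have : (U j).obj (Q i A hA).pow = ((S j).power i _ (hA j)).pow :=
              congrArg Comma.right (hQ i A hA j (hA j)).memPow
            rw [this]
            exact (S j).power_mem i _ _ },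
    fun j ↦ ⟨hR j, ⟨(hN' j).1, (hN' j).2⟩, fun i X hX ↦ hX j, fun i ↦ hR' i j,
      fun i A hA ↦ hQ i A hA j (hA j)⟩, fun i X ↦ Iff.rfl⟩

end JointlyCreates

end Creation

/-! ### Recognising chosen universal maps up to equality of arrows. -/

section Chosen

variable {C : Type u₁} [Category.{v₁} C]

theorem NNOStr.isNNO_of_arrow {S : RegularStr C} (N : NNOStr S) {T M : C} {z : T ⟶ M} {s : M ⟶ M}
    (hz : Arrow.mk z = Arrow.mk N.zero) (hs : Arrow.mk s = Arrow.mk N.succ) : IsNNO z s := by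
  obtain rfl : T = S.one := congrArg Comma.left hz
  obtain rfl : M = N.nat := congrArg Comma.right hz
  obtain rfl := (Arrow.mk_inj _ _).1 hz
  obtain rfl := (Arrow.mk_inj _ _).1 hs
  exact N.isNNO

theorem PowerObject.isPowerObject_of_arrow {A : C} (Q : PowerObject A) {P M : C} {memP : M ⟶ P}
    {memA : M ⟶ A} (hP : Arrow.mk memP = Arrow.mk Q.memPow)
    (hA : Arrow.mk memA = Arrow.mk Q.memBase) : IsPowerObject memP memA := by
  obtain rfl : M = Q.mem := congrArg Comma.left hA
  obtain rfl : P = Q.pow := congrArg Comma.right hP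
  obtain rfl := (Arrow.mk_inj _ _).1 hP
  obtain rfl := (Arrow.mk_inj _ _).1 hA
  exact Q.isPowerObject

end Chosen

/-! ### Products -/

section Product

variable {J : Type u} {C : J → Type u₁} [∀ j, Category.{v₁} (C j)]

theorem isPullback_pi {W X Y Z : ∀ j, C j} {p : W ⟶ X} {q : W ⟶ Y} {f : X ⟶ Z} {g : Y ⟶ Z}
    (h : ∀ j, IsPullback (p j) (q j) (f j) (g j)) : IsPullback p q f g :=
  .mk' (funext fun j ↦ (h j).w)
    (fun _ _ _ h₁ h₂ ↦ funext fun j ↦ (h j).hom_ext (congrFun h₁ j) (congrFun h₂ j))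
    fun _ a b hab ↦ ⟨fun j ↦ (h j).lift (a j) (b j) (congrFun hab j),
      funext fun j ↦ (h j).lift_fst _ _ _, funext fun j ↦ (h j).lift_snd _ _ _⟩

theorem jointlyCreatesRegs_pi (S : ∀ j, RankedToposStr (C j)) :
    JointlyCreatesRegs (Pi.eval C) S where
  faithful f g h := funext h
  conservative f h := isIso_pi_iff f |>.2 h
  one k := by
    choose W hW using fun j ↦ (S j).exists_selOne k
    have hW' (j : J) := (hW j).isTerminal.some
    exact ⟨W, ⟨IsTerminal.ofUniqueHom (fun X j ↦ (hW' j).from (X j))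
      fun X f ↦ funext fun j ↦ (hW' j).hom_ext _ _⟩, hW⟩
  pb k X Y Z f g hX hY hZ := by
    choose W p q h using fun j ↦ (S j).exists_selPb k (f j) (g j) (hX j) (hY j) (hZ j)
    exact ⟨W, p, q, isPullback_pi fun j ↦ (h j).isPullback, h⟩
  im k X Y f hX hY := by
    choose I e m h using fun j ↦ (S j).exists_selIm k (f j) (hX j) (hY j)
    exact ⟨I, e, m, funext fun j ↦ (h j).fac, h⟩

theorem jointlyCreates_pi (S : ∀ j, RankedToposStr (C j)) :
    JointlyCreates (Pi.eval C) S where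
  toJointlyCreatesRegs := jointlyCreatesRegs_pi S
  nno T hT h := by
    obtain rfl : T = fun j ↦ (S j).reg.one := funext h
    exact ⟨fun j ↦ (S j).nno.nat, fun j ↦ (S j).nno.zero, fun j ↦ (S j).nno.succ,
      (jointlyCreatesRegs_pi S).reg.isNNO hT (fun j ↦ (S j).nno.isNNO) fun _ _ l _ ↦
        ⟨l, fun _ ↦ rfl⟩, fun j ↦ ⟨rfl, rfl⟩⟩
  power i A h := ⟨⟨fun j ↦ ((S j).power i (A j) (h j)).pow, fun j ↦ ((S j).power i (A j) (h j)).mem,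
    fun j ↦ ((S j).power i (A j) (h j)).memPow, fun j ↦ ((S j).power i (A j) (h j)).memBase,
    (jointlyCreatesRegs_pi S).reg.isPowerObject
      (fun j ↦ ((S j).power i (A j) (h j)).isPowerObject) (fun _ _ l _ ↦ ⟨l, fun _ ↦ rfl⟩)
      fun _ _ χ _ ↦ ⟨χ, fun _ ↦ rfl⟩⟩, fun _ _ ↦ ⟨rfl, rfl⟩⟩

end Product

/-! ### Substructures -/

section Sub

variable {D : Type u₁} [Category.{v₁} D]

/-- Objects are those whose identity lies in `A`. Shrinking objects and hom-sets brings the category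
into `Type w`, however large `D` is. -/
theorem exists_category_of_morphismProperty (A : MorphismProperty D) [Small.{w} A.toSet]
    (comp : ∀ {X Y Z : D} (f : X ⟶ Y) (g : Y ⟶ Z), A f → A g → A (f ≫ g)) :
    ∃ (K : Type w) (_ : SmallCategory K) (V : K ⥤ D),
      (∀ X, A (𝟙 X) → ∃ K, V.obj K = X) ∧ Function.Injective V.obj ∧ V.Faithful ∧
        ∀ {X Y : K} (f : V.obj X ⟶ V.obj Y), A f ↔ ∃ f', V.map f' = f := by
  have : Small.{w} {X : D // A (𝟙 X)} :=
    small_of_injective (β := A.toSet) (f := fun X ↦ ⟨Arrow.mk (𝟙 X.1), X.2⟩) fun X Y h ↦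
      Subtype.ext (congrArg (fun x ↦ Comma.left x.1) h)
  have (X Y : D) : Small.{w} {f : X ⟶ Y // A f} :=
    small_of_injective (β := A.toSet) (f := fun f ↦ ⟨Arrow.mk f.1, f.2⟩) fun f g h ↦
      Subtype.ext ((Arrow.mk_inj _ _).1 (congrArg (fun x ↦ x.1) h))
  let ob (X : Shrink.{w} {X : D // A (𝟙 X)}) : D := ((equivShrink _).symm X).1
  let cat : SmallCategory (Shrink.{w} {X : D // A (𝟙 X)}) :=
    { Hom X Y := Shrink.{w} {f : ob X ⟶ ob Y // A f}
      id X := equivShrink _ ⟨𝟙 _, ((equivShrink _).symm X).2⟩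
      comp f g := equivShrink _ ⟨((equivShrink _).symm f).1 ≫ ((equivShrink _).symm g).1,
        comp _ _ ((equivShrink _).symm f).2 ((equivShrink _).symm g).2⟩
      id_comp f := by simp
      comp_id f := by simp
      assoc f g h := by simp }
  refine ⟨_, cat, { obj := ob, map f := ((equivShrink _).symm f).1, map_id X := ?_,
                    map_comp f g := ?_ }, fun X hX ↦ ⟨equivShrink _ ⟨X, hX⟩, ?_⟩, ?_, ⟨?_⟩, ?_⟩
  · exact congrArg Subtype.val ((equivShrink _).symm_apply_apply _)
  · exact congrArg Subtype.val ((equivShrink _).symm_apply_apply _)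
  · exact congrArg Subtype.val ((equivShrink _).symm_apply_apply _)
  · exact fun X Y h ↦ (equivShrink _).symm.injective (Subtype.val_injective h)
  · exact fun h ↦ (equivShrink _).symm.injective (Subtype.val_injective h)
  · intro X Y f
    refine ⟨fun hf ↦ ⟨equivShrink _ ⟨f, hf⟩, ?_⟩, ?_⟩
    · exact congrArg Subtype.val ((equivShrink _).symm_apply_apply _)
    · rintro ⟨f', rfl⟩
      exact ((equivShrink _).symm f').2

/-- A class of maps that is closed under the operations of an `∞`-ranked topos. -/
structure IsClosed (S : RankedToposStr D) (A : MorphismProperty D) : Prop where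
  id_left : ∀ {X Y : D} (f : X ⟶ Y), A f → A (𝟙 X)
  id_right : ∀ {X Y : D} (f : X ⟶ Y), A f → A (𝟙 Y)
  comp : ∀ {X Y Z : D} (f : X ⟶ Y) (g : Y ⟶ Z), A f → A g → A (f ≫ g)
  one : ∀ {k} {W : D}, S.SelOne k W → A (𝟙 W)
  toTerminal : ∀ {X W : D} (f : X ⟶ W), Nonempty (IsTerminal W) → A (𝟙 X) → A (𝟙 W) → A f
  pb : ∀ {k} {W X Y Z : D} {f : X ⟶ Z} {g : Y ⟶ Z} {p : W ⟶ X} {q : W ⟶ Y},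
    S.SelPb f g p q k → A f → A g → A p ∧ A q
  lift : ∀ {W X Y Z : D} {p : W ⟶ X} {q : W ⟶ Y} (l : Z ⟶ W), IsRelation p q → A p → A q →
    A (l ≫ p) → A (l ≫ q) → A l
  im : ∀ {k} {X Y I : D} {f : X ⟶ Y} {e : X ⟶ I} {m : I ⟶ Y}, S.SelIm f e m k → A f → A e ∧ A m
  zero : A S.nno.zero
  succ : A S.nno.succ
  recursor : ∀ {X : D} (l : S.nno.nat ⟶ X) (t : X ⟶ X), A (S.nno.zero ≫ l) → A t →
    S.nno.succ ≫ l = l ≫ t → A l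
  power : ∀ {i} {X : D} (h : S.rank i X), A (𝟙 X) →
    A (S.power i X h).memPow ∧ A (S.power i X h).memBase
  classifier : ∀ {i} {X : D} (h : S.rank i X) {B R : D} {r : R ⟶ B} {s : R ⟶ X}
    {χ : B ⟶ (S.power i X h).pow}, A r → A s →
    Classifies (S.power i X h).memPow (S.power i X h).memBase r s χ → A χ

namespace IsClosed

variable {S : RankedToposStr D} {A : MorphismProperty D}

theorem jointlyCreates (hA : IsClosed S A) {K : Type u₂} [Category.{v₂} K] {V : K ⥤ D}
    (hob : ∀ X, A (𝟙 X) → ∃ K, V.obj K = X) (hV : V.Faithful)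
    (hhom : ∀ {X Y : K} (f : V.obj X ⟶ V.obj Y), A f ↔ ∃ f', V.map f' = f) :
    JointlyCreates (fun _ : PUnit.{1} ↦ V) (fun _ ↦ S) := by
  have hmap {X Y : K} (f : X ⟶ Y) : A (V.map f) := (hhom _).2 ⟨f, rfl⟩
  have hid (X : K) : A (𝟙 (V.obj X)) := by simpa using hmap (𝟙 X)
  have regs : JointlyCreatesRegs (fun _ : PUnit.{1} ↦ V) (fun _ ↦ S) :=
    { faithful f g h := V.map_injective (h ⟨⟩)
      conservative f h := by
        have := h ⟨⟩
        -- The inverse is an induced map along the relation `(f, f)`, so closure under `lift`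
        -- contains it.
        obtain ⟨g, hg⟩ := (hhom (inv (V.map f))).1 (hA.lift _ (.of_mono (V.map f)) (hmap f)
          (hmap f) (by simpa using hid _) (by simpa using hid _))
        exact ⟨g, V.map_injective (by simp [hg]), V.map_injective (by simp [hg])⟩
      one k := by
        obtain ⟨W, hW⟩ := S.exists_selOne k
        obtain ⟨W, rfl⟩ := hob W (hA.one hW)
        obtain ⟨hT⟩ := hW.isTerminal
        choose f hf using fun X ↦ (hhom (hT.from (V.obj X))).1
          (hA.toTerminal _ ⟨hT⟩ (hid X) (hid W))
        exact ⟨W, ⟨IsTerminal.ofUniqueHom f fun X g ↦ V.map_injective (hT.hom_ext _ _)⟩,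
          fun _ ↦ hW⟩
      pb k X Y Z f g hX hY hZ := by
        obtain ⟨W, p, q, h⟩ := S.exists_selPb k (V.map f) (V.map g) (hX ⟨⟩) (hY ⟨⟩) (hZ ⟨⟩)
        obtain ⟨hp, hq⟩ := hA.pb h (hmap f) (hmap g)
        obtain ⟨W, rfl⟩ := hob W (hA.id_left _ hp)
        obtain ⟨p, rfl⟩ := (hhom p).1 hp
        obtain ⟨q, rfl⟩ := (hhom q).1 hq
        refine ⟨W, p, q, .mk' (V.map_injective (by simpa using h.isPullback.w))
          (fun T a b h₁ h₂ ↦ V.map_injective (h.isPullback.hom_ext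
            (by simp [← V.map_comp, -Functor.map_comp, h₁])
            (by simp [← V.map_comp, -Functor.map_comp, h₂])))
          (fun T a b hab ↦ ?_), fun _ ↦ h⟩
        obtain ⟨l, hl₁, hl₂⟩ := h.isPullback.exists_lift (V.map a) (V.map b)
          (by rw [← V.map_comp, hab, V.map_comp])
        obtain ⟨l, rfl⟩ := (hhom l).1 (hA.lift l (.of_isPullback h.isPullback) hp hq
          (hl₁ ▸ hmap a) (hl₂ ▸ hmap b))
        exact ⟨l, V.map_injective (by simp [hl₁]), V.map_injective (by simp [hl₂])⟩
      im k X Y f hX hY := by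
        obtain ⟨I, e, m, h⟩ := S.exists_selIm k (V.map f) (hX ⟨⟩) (hY ⟨⟩)
        obtain ⟨he, hm⟩ := hA.im h (hmap f)
        obtain ⟨I, rfl⟩ := hob I (hA.id_left _ hm)
        obtain ⟨e, rfl⟩ := (hhom e).1 he
        obtain ⟨m, rfl⟩ := (hhom m).1 hm
        exact ⟨I, e, m, V.map_injective (by simpa using h.fac), fun _ ↦ h⟩ }
  refine { regs with nno := fun T hT h ↦ ?_, power := fun i X hX ↦ ?_ }
  -- The chosen zero starts at `S.reg.one`, equal to `V.obj T` only propositionally. Generalising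
  -- its source allows substitution.
  · suffices key : ∀ {T' N : D} (z : T' ⟶ N) (s : N ⟶ N), A z → A s →
        (∀ {X : D} (l : N ⟶ X) (t : X ⟶ X), A (z ≫ l) → A t → s ≫ l = l ≫ t → A l) →
        Arrow.mk z = Arrow.mk S.nno.zero → Arrow.mk s = Arrow.mk S.nno.succ → V.obj T = T' →
        ∃ (N : K) (z : T ⟶ N) (s : N ⟶ N), IsNNO z s ∧ ∀ _ : PUnit.{1},
          Arrow.mk (V.map z) = Arrow.mk S.nno.zero ∧ Arrow.mk (V.map s) = Arrow.mk S.nno.succ from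
      key _ _ hA.zero hA.succ hA.recursor rfl rfl (h ⟨⟩)
    rintro T' N z s hz hs hrec hz' hs' rfl
    obtain ⟨N, rfl⟩ := hob N (hA.id_left _ hs)
    obtain ⟨z, rfl⟩ := (hhom z).1 hz
    obtain ⟨s, rfl⟩ := (hhom s).1 hs
    refine ⟨N, z, s, regs.reg.isNNO hT (fun _ ↦ S.nno.isNNO_of_arrow hz' hs') ?_,
      fun _ ↦ ⟨hz', hs'⟩⟩
    intro X a t l hl
    obtain ⟨l', hl'⟩ := (hhom (l ⟨⟩)).1 (hrec _ (V.map t) ((hl ⟨⟩).1 ▸ hmap a) (hmap t) (hl ⟨⟩).2)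
    exact ⟨l', fun _ ↦ hl'⟩
  · have hP := hA.power (hX ⟨⟩) (hid X)
    have hcl := @hA.classifier i _ (hX ⟨⟩)
    suffices ∃ Q : PowerObject X, IsStrictPower V Q (S.power i _ (hX ⟨⟩)) from
      this.imp fun Q hQ _ _ ↦ hQ
    generalize S.power i _ (hX ⟨⟩) = Q at hP hcl
    obtain ⟨Q, M, memP, memX, hQ⟩ := Q
    dsimp only at hP hcl
    obtain ⟨Q, rfl⟩ := hob Q (hA.id_right _ hP.1)
    obtain ⟨M, rfl⟩ := hob M (hA.id_left _ hP.1)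
    obtain ⟨memP, rfl⟩ := (hhom memP).1 hP.1
    obtain ⟨memX, rfl⟩ := (hhom memX).1 hP.2
    refine ⟨⟨Q, M, memP, memX, regs.reg.isPowerObject (fun _ ↦ hQ) ?_ ?_⟩, rfl, rfl⟩
    · intro Z x y l hl
      obtain ⟨l', hl'⟩ := (hhom (l ⟨⟩)).1 (hA.lift _ hQ.1 hP.1 hP.2
        ((hl ⟨⟩).1 ▸ hmap x) ((hl ⟨⟩).2 ▸ hmap y))
      exact ⟨l', fun _ ↦ hl'⟩
    · intro B R r s χ hχ
      obtain ⟨χ', hχ'⟩ := (hhom (χ ⟨⟩)).1 (hcl (hmap r) (hmap s) (hχ ⟨⟩))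
      exact ⟨χ', fun _ ↦ hχ'⟩

/-- A small class of maps that is closed under the operations of an `∞`-ranked topos is itself an
`∞`-ranked topos. -/
theorem exists_strRankedTopos (hA : IsClosed S A) [Small.{w} A.toSet] :
    ∃ (R : StrRankedTopos.{w}) (V : R ⥤ D), IsStrictRankedLogical R.str S V ∧
      (∀ i X, R.str.rank i X ↔ S.rank i (V.obj X)) ∧ Function.Injective V.obj ∧ V.Faithful ∧
        ∀ {X Y : R} (f : X ⟶ Y), A (V.map f) := by
  obtain ⟨K, _, V, hob, hinj, hV, hhom⟩ := exists_category_of_morphismProperty A hA.comp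
  obtain ⟨S', hS', hr⟩ := (hA.jointlyCreates hob hV hhom).exists_rankedToposStr
  exact ⟨⟨K, S'⟩, V, hS' ⟨⟩, fun i X ↦ (hr i X).trans ⟨fun h ↦ h ⟨⟩, fun h _ ↦ h⟩, hinj, hV,
    fun f ↦ (hhom _).2 ⟨f, rfl⟩⟩

end IsClosed

end Sub

/-! ### Generated substructures -/

section Generation

/-- A set is contained in a countable set that is closed under countably many partial operations. -/
theorem exists_countable_closed {X : Type u} {ι : Type v} [Countable ι]
    (Φ : ι → List X → X → Prop) (h : ∀ i l x y, Φ i l x → Φ i l y → x = y) :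
    ∃ A : Set X, A.Countable ∧ ∀ i l x, (∀ y ∈ l, y ∈ A) → Φ i l x → x ∈ A := by
  let step (A : Set X) : Set X := A ∪ ⋃ i, ⋃ l : List A, {x | Φ i (l.map Subtype.val) x}
  let L (n : ℕ) : Set X := step^[n] ∅
  have hL (n : ℕ) : L (n + 1) = step (L n) := Function.iterate_succ_apply' step n ∅
  have hmono : Monotone L := monotone_nat_of_le_succ fun n ↦ by
    rw [hL]
    exact Set.subset_union_left
  have hcount (n : ℕ) : (L n).Countable := by
    induction n with
    | zero => exact Set.countable_empty
    | succ n ih =>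
      rw [hL]
      -- There are countably many lists over `L n` and countably many operations, each with at most
      -- one result per list.
      have : Countable (L n) := ih
      exact ih.union (Set.countable_iUnion fun i ↦ Set.countable_iUnion fun l ↦
        Set.Subsingleton.countable fun x hx y hy ↦ h i _ x y hx hy)
  refine ⟨⋃ n, L n, Set.countable_iUnion hcount, fun i l x hl hx ↦ ?_⟩
  obtain ⟨n, hn⟩ : ∃ n, ∀ y ∈ l, y ∈ L n := by
    clear hx
    induction l with
    | nil => exact ⟨0, by simp⟩
    | cons a l ih =>
      obtain ⟨n, hn⟩ := ih fun y hy ↦ hl y (List.mem_cons_of_mem _ hy)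
      obtain ⟨m, hm⟩ := Set.mem_iUnion.1 (hl a List.mem_cons_self)
      refine ⟨max n m, fun y hy ↦ ?_⟩
      obtain rfl | hy := List.mem_cons.1 hy
      · exact hmono (le_max_right _ _) hm
      · exact hmono (le_max_left _ _) (hn y hy)
  refine Set.mem_iUnion.2 ⟨n + 1, ?_⟩
  rw [hL]
  refine Or.inr (Set.mem_iUnion₂.2 ⟨i, l.attachWith _ hn, ?_⟩)
  simpa using hx

variable {D : Type u₁} [Category.{v₁} D]

/-- The operations of an `∞`-ranked topos, as a relation between finite lists of maps and maps. -/
inductive Operation (S : RankedToposStr D) : ℕ × Option ℕ → List (Arrow D) → Arrow D → Prop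
  | id_left {k} {X Y : D} (f : X ⟶ Y) : Operation S (0, k) [Arrow.mk f] (Arrow.mk (𝟙 X))
  | id_right {k} {X Y : D} (f : X ⟶ Y) : Operation S (1, k) [Arrow.mk f] (Arrow.mk (𝟙 Y))
  | comp {k} {X Y Z : D} (f : X ⟶ Y) (g : Y ⟶ Z) :
    Operation S (2, k) [Arrow.mk f, Arrow.mk g] (Arrow.mk (f ≫ g))
  | one {k} {W : D} : S.SelOne k W → Operation S (3, k) [] (Arrow.mk (𝟙 W))
  | toTerminal {k} {X X' W W' : D} (a : X ⟶ X') (b : W ⟶ W') (f : X ⟶ W) :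
    Nonempty (IsTerminal W) → Operation S (4, k) [Arrow.mk a, Arrow.mk b] (Arrow.mk f)
  | pbFst {k} {W X Y Z : D} {f : X ⟶ Z} {g : Y ⟶ Z} {p : W ⟶ X} {q : W ⟶ Y} :
    S.SelPb f g p q k → Operation S (5, k) [Arrow.mk f, Arrow.mk g] (Arrow.mk p)
  | pbSnd {k} {W X Y Z : D} {f : X ⟶ Z} {g : Y ⟶ Z} {p : W ⟶ X} {q : W ⟶ Y} :
    S.SelPb f g p q k → Operation S (6, k) [Arrow.mk f, Arrow.mk g] (Arrow.mk q)
  | lift {k} {W X Y Z : D} {p : W ⟶ X} {q : W ⟶ Y} {l : Z ⟶ W} {a : Z ⟶ X} {b : Z ⟶ Y} :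
    IsRelation p q → l ≫ p = a → l ≫ q = b →
      Operation S (7, k) [Arrow.mk p, Arrow.mk q, Arrow.mk a, Arrow.mk b] (Arrow.mk l)
  | imCover {k} {X Y I : D} {f : X ⟶ Y} {e : X ⟶ I} {m : I ⟶ Y} :
    S.SelIm f e m k → Operation S (8, k) [Arrow.mk f] (Arrow.mk e)
  | imMono {k} {X Y I : D} {f : X ⟶ Y} {e : X ⟶ I} {m : I ⟶ Y} :
    S.SelIm f e m k → Operation S (9, k) [Arrow.mk f] (Arrow.mk m)
  | zero {k} : Operation S (10, k) [] (Arrow.mk S.nno.zero)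
  | succ {k} : Operation S (11, k) [] (Arrow.mk S.nno.succ)
  | recursor {k} {T X X' : D} {a : T ⟶ X} {t : X ⟶ X'} (e : X' = X) (l : S.nno.nat ⟶ X) :
    Arrow.mk (S.nno.zero ≫ l) = Arrow.mk a → S.nno.succ ≫ l = l ≫ t ≫ eqToHom e →
      Operation S (12, k) [Arrow.mk a, Arrow.mk t] (Arrow.mk l)
  | memPow {i} {X Y : D} (f : X ⟶ Y) (h : S.rank i X) :
    Operation S (13, some i) [Arrow.mk f] (Arrow.mk (S.power i X h).memPow)
  | memBase {i} {X Y : D} (f : X ⟶ Y) (h : S.rank i X) :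
    Operation S (14, some i) [Arrow.mk f] (Arrow.mk (S.power i X h).memBase)
  | classifier {i} {X : D} (h : S.rank i X) {B R : D} {r : R ⟶ B} {s : R ⟶ X}
    {χ : B ⟶ (S.power i X h).pow} :
    Classifies (S.power i X h).memPow (S.power i X h).memBase r s χ →
      Operation S (15, some i) [Arrow.mk r, Arrow.mk s] (Arrow.mk χ)

theorem Classifies.isRelation {A P M B R : D} {memP : M ⟶ P} {memA : M ⟶ A} {r : R ⟶ B}
    {s : R ⟶ A} {χ : B ⟶ P} (h : Classifies memP memA r s χ) (hM : IsRelation memP memA) :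
    IsRelation r s := by
  obtain ⟨k, hk, rfl⟩ := h
  intro Z a b h₁ h₂
  refine hk.hom_ext (hM _ _ ?_ (by simpa using h₂)) h₁
  simp [hk.w, reassoc_of% h₁]

/-- Each list records enough to determine the result: two maps for the source and target of a map to
a terminal object, both legs and both composites for an induced map, base value and step for a
recursor, both legs of the relation for a classifying map. -/
theorem Operation.unique {S : RankedToposStr D} {o : ℕ × Option ℕ} {l : List (Arrow D)}
    {x y : Arrow D} (h : Operation S o l x) (h' : Operation S o l y) : x = y := by
  cases h with
  | id_left f => cases h'; rfl
  | id_right f => cases h'; rfl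
  | comp f g => cases h'; rfl
  | one h => cases h' with | one h' => rw [h.unique h']
  | toTerminal a b f h =>
    cases h' with | toTerminal _ _ f' h' => rw [h.some.hom_ext f f']
  | pbFst h => cases h' with | pbFst h' => exact (h.unique h' rfl rfl).1
  | pbSnd h => cases h' with | pbSnd h' => exact (h.unique h' rfl rfl).2
  | lift h h₁ h₂ =>
    cases h' with | lift h' h₁' h₂' => rw [h _ _ (h₁.trans h₁'.symm) (h₂.trans h₂'.symm)]
  | imCover h => cases h' with | imCover h' => exact (h.unique h' rfl).1
  | imMono h => cases h' with | imMono h' => exact (h.unique h' rfl).2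
  | zero => cases h'; rfl
  | succ => cases h'; rfl
  | recursor e l h₁ h₂ =>
    cases h' with
    | recursor e' l' h₁' h₂' =>
      subst e
      have := (Arrow.mk_inj _ _).1 (h₁.trans h₁'.symm)
      rw [(S.nno.isNNO.2 _ _).unique ⟨this, by simpa using h₂⟩ ⟨rfl, by simpa using h₂'⟩]
  | memPow f h => cases h'; rfl
  | memBase f h => cases h'; rfl
  | classifier h hχ =>
    cases h' with
    | classifier h' hχ' =>
      have hP := (S.power _ _ h).isPowerObject
      rw [(hP.2 _ _ (hχ.isRelation hP.1)).unique hχ hχ']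

theorem exists_isClosed (S : RankedToposStr D) :
    ∃ A : MorphismProperty D, IsClosed S A ∧ A.toSet.Countable := by
  obtain ⟨A, hA, h⟩ := exists_countable_closed (Operation S) fun _ _ _ _ ↦ Operation.unique
  refine ⟨fun X Y f ↦ Arrow.mk f ∈ A, ?_, hA⟩
  exact
    { id_left f hf := h _ _ _ (by simpa using hf) (.id_left (k := none) f)
      id_right f hf := h _ _ _ (by simpa using hf) (.id_right (k := none) f)
      comp f g hf hg := h _ _ _ (by simpa using ⟨hf, hg⟩) (.comp (k := none) f g)
      one hW := h _ _ _ (by simp) (.one hW)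
      toTerminal f hW hX hW' := h _ _ _ (by simpa using ⟨hX, hW'⟩)
        (.toTerminal (k := none) (𝟙 _) (𝟙 _) f hW)
      pb hs hf hg := ⟨h _ _ _ (by simpa using ⟨hf, hg⟩) (.pbFst hs),
        h _ _ _ (by simpa using ⟨hf, hg⟩) (.pbSnd hs)⟩
      lift l hr hp hq ha hb := h _ _ _ (by simpa using ⟨hp, hq, ha, hb⟩)
        (.lift (k := none) hr rfl rfl)
      im hs hf := ⟨h _ _ _ (by simpa using hf) (.imCover hs),
        h _ _ _ (by simpa using hf) (.imMono hs)⟩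
      zero := h _ _ _ (by simp) (.zero (k := none))
      succ := h _ _ _ (by simp) (.succ (k := none))
      recursor l t ha ht hl := h _ _ _ (by simpa using ⟨ha, ht⟩)
        (.recursor (k := none) rfl l rfl (by simpa using hl))
      power hX hX' := ⟨h _ _ _ (by simpa using hX') (.memPow _ hX),
        h _ _ _ (by simpa using hX') (.memBase _ hX)⟩
      classifier hX _ _ _ _ _ hr hs hχ := h _ _ _ (by simpa using ⟨hr, hs⟩) (.classifier hX hχ) }

/-- Every family of `∞`-ranked toposes receives strict functors from a single small one. -/
theorem exists_strRankedTopos_family {J : Type u} {C : J → Type u₁} [∀ j, Category.{v₁} (C j)]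
    (S : ∀ j, RankedToposStr (C j)) :
    ∃ (R : StrRankedTopos.{w}) (V : ∀ j, R ⥤ C j),
      (∀ j, IsStrictRankedLogical R.str (S j) (V j)) ∧
        ∀ i X, (∀ j, (S j).rank i ((V j).obj X)) → R.str.rank i X := by
  obtain ⟨S', hS', hr⟩ := (jointlyCreates_pi S).exists_rankedToposStr
  obtain ⟨A, hA, hc⟩ := exists_isClosed S'
  -- Countability makes the substructure small in every universe, whatever the sizes of `J` and the
  -- `C j`.
  have : Countable A.toSet := hc
  obtain ⟨R, V, hV, hr', -⟩ := IsClosed.exists_strRankedTopos.{w} hA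
  exact ⟨R, fun j ↦ V ⋙ Pi.eval C j, fun j ↦ hV.comp (hS' j), fun i X h ↦
    (hr' i X).2 ((hr i _).2 h)⟩

end Generation

/-! ### Toposes as `∞`-ranked toposes -/

section ToRanked

variable {C : Type u₁} [Category.{v₁} C] {D : Type u₂} [Category.{v₂} D]

theorem jointlyCreatesReg_total (S : RegularStr C) :
    JointlyCreatesReg (fun _ : PUnit.{1} ↦ ObjectProperty.ι (fun _ : C ↦ True)) fun _ ↦ S where
  faithful _ _ h := ObjectProperty.hom_ext _ (h ⟨⟩)
  conservative f h := (ObjectProperty.isIso_hom_iff f).1 (h ⟨⟩)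
  one := ⟨⟨S.one, trivial⟩, ⟨IsTerminal.ofUniqueHom (fun X ↦ ⟨S.isTerminal.from X.obj⟩)
    fun _ _ ↦ ObjectProperty.hom_ext _ (S.isTerminal.hom_ext _ _)⟩, fun _ ↦ rfl⟩
  pb f g := ⟨⟨S.pb f.hom g.hom, trivial⟩, ⟨S.pbFst f.hom g.hom⟩, ⟨S.pbSnd f.hom g.hom⟩,
    IsPullback.of_map_of_faithful (ObjectProperty.ι _) (S.isPullback f.hom g.hom), fun _ ↦ .mk⟩
  im f := ⟨⟨S.im f.hom, trivial⟩, ⟨S.imCover f.hom⟩, ⟨S.imMono f.hom⟩,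
    ObjectProperty.hom_ext _ (S.im_fac f.hom), fun _ ↦ .mk⟩

/-- The regular structure on the full subcategory of all objects. -/
def RegularStr.total (S : RegularStr C) :
    RegularStr (ObjectProperty.FullSubcategory (fun _ : C ↦ True)) where
  one := ⟨S.one, trivial⟩
  isTerminal := IsTerminal.ofUniqueHom (fun X ↦ ⟨S.isTerminal.from X.obj⟩)
    fun _ _ ↦ ObjectProperty.hom_ext _ (S.isTerminal.hom_ext _ _)
  pb f g := ⟨S.pb f.hom g.hom, trivial⟩
  pbFst f g := ⟨S.pbFst f.hom g.hom⟩
  pbSnd f g := ⟨S.pbSnd f.hom g.hom⟩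
  isPullback f g := IsPullback.of_map_of_faithful (ObjectProperty.ι _) (S.isPullback f.hom g.hom)
  im f := ⟨S.im f.hom, trivial⟩
  imCover f := ⟨S.imCover f.hom⟩
  imMono f := ⟨S.imMono f.hom⟩
  im_fac f := ObjectProperty.hom_ext _ (S.im_fac f.hom)
  isCover_imCover f := (jointlyCreatesReg_total S).isCover fun _ ↦ S.isCover_imCover f.hom
  mono_imMono f := (jointlyCreatesReg_total S).mono fun _ ↦ S.mono_imMono f.hom
  cover_stable hP hg := (jointlyCreatesReg_total S).isCover fun _ ↦ S.cover_stable
    (((jointlyCreatesReg_total S).isRegularFunctor ⟨⟩).isPullback hP)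
    (((jointlyCreatesReg_total S).isRegularFunctor ⟨⟩).map_cover _ hg)

/-- A topos is an `∞`-ranked topos in which every object has rank `0`. -/
def ToposStr.toRanked (S : ToposStr C) : RankedToposStr C where
  reg := S.reg
  nno := S.nno
  rank _ _ := True
  rank_mono _ _ _ := trivial
  rankReg _ := S.reg.total
  rank_regular _ := (jointlyCreatesReg_total S.reg).isRegularFunctor ⟨⟩
  nat_mem _ := trivial
  power _ A _ := S.power A
  power_mem _ _ _ := trivial

theorem arrow_mk_total {X Y X' Y' : ObjectProperty.FullSubcategory (fun _ : C ↦ True)} {f : X ⟶ Y}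
    {g : X' ⟶ Y'} (h : Arrow.mk f.hom = Arrow.mk g.hom) : Arrow.mk f = Arrow.mk g :=
  congrArg (ObjectProperty.lift (fun _ : C ↦ True) (𝟭 C) fun _ ↦ trivial).mapArrow.obj h

theorem IsStrictLogical.toRanked {S : ToposStr C} {S' : ToposStr D} {F : C ⥤ D}
    (hF : IsStrictLogical S S' F) : IsStrictRankedLogical S.toRanked S'.toRanked F where
  reg := hF.reg
  nno := hF.nno
  rank _ _ h := h
  rankReg _ := ⟨ObjectProperty.FullSubcategory.ext hF.reg.one,
    fun _ _ ↦ arrow_mk_total (hF.reg.pbFst _ _), fun _ _ ↦ arrow_mk_total (hF.reg.pbSnd _ _),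
    fun _ ↦ arrow_mk_total (hF.reg.imCover _), fun _ ↦ arrow_mk_total (hF.reg.imMono _)⟩
  power _ A _ := hF.power A

/-- An `∞`-ranked topos in which every object has rank `0` is a topos. -/
def RankedToposStr.toTopos (S : RankedToposStr C) (h : ∀ X, S.rank 0 X) : ToposStr C where
  reg := S.reg
  nno := S.nno
  power A := S.power 0 A (h A)

theorem IsStrictRankedLogical.toTopos {S : RankedToposStr C} {S' : ToposStr D} {F : C ⥤ D}
    (hF : IsStrictRankedLogical S S'.toRanked F) (h : ∀ X, S.rank 0 X) :
    IsStrictLogical (S.toTopos h) S' F :=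
  ⟨hF.reg, hF.nno, fun A ↦ hF.power 0 A (h A)⟩

end ToRanked

/-! ### Strict functors are logical -/

section Logical

variable {C : Type u₁} [Category.{v₁} C] {D : Type u₂} [Category.{v₂} D] {E : Type u₃}
  [Category.{v₃} E]

theorem IsStrictNNO.preservesNNO {S : RegularStr C} {S' : RegularStr D} {N : NNOStr S}
    {N' : NNOStr S'} {F : C ⥤ D} (hF : IsStrictNNO N N' F) : PreservesNNO F := by
  intro T M z s h
  obtain ⟨t, n, hz, hs⟩ := N.isNNO.unique_iso h
  exact (N'.isNNO_of_arrow hF.zero hF.succ).of_iso (F.mapIso t) (F.mapIso n)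
    (by simp [← F.map_comp, -Functor.map_comp, hz]) (by simp [← F.map_comp, -Functor.map_comp, hs])

/-- Power-objects of isomorphic objects are isomorphic, so preservation need only be tested on one
of them. -/
theorem IsPowerObject.map_of_iso {F : C ⥤ D} {A P M A' P' M' : C} {memP : M ⟶ P} {memA : M ⟶ A}
    {memP' : M' ⟶ P'} {memA' : M' ⟶ A'} (h : IsPowerObject memP memA)
    (hF : IsPowerObject (F.map memP) (F.map memA)) (h' : IsPowerObject memP' memA') (a : A ≅ A') :
    IsPowerObject (F.map memP') (F.map memA') := by
  obtain ⟨p, m, hp, ha⟩ := h.exists_iso h' a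
  exact hF.of_iso (F.mapIso a) (F.mapIso p) (F.mapIso m)
    (by simp [← F.map_comp, -Functor.map_comp, hp]) (by simp [← F.map_comp, -Functor.map_comp, ha])

theorem IsStrictRankedLogical.isLogicalFrom {S : RankedToposStr C} {S' : RankedToposStr D}
    {F : C ⥤ D} (hF : IsStrictRankedLogical S S' F) : IsLogicalFrom S F :=
  ⟨hF.reg.isRegularFunctor, hF.nno.preservesNNO, fun i A h ↦
    (S'.power i (F.obj A) (hF.rank i A h)).isPowerObject_of_arrow (hF.power i A h).memPow
      (hF.power i A h).memBase⟩

/-- If every object is isomorphic to an object with a rank, then the preservation of the chosen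
power-objects implies that of all power-objects. -/
theorem IsLogicalFrom.isLogical {S : RankedToposStr C} {F : C ⥤ D} (hF : IsLogicalFrom S F)
    (h : ∀ X, ∃ i Y, S.rank i Y ∧ Nonempty (X ≅ Y)) : IsLogical F := by
  refine ⟨hF.regular, hF.nno, fun {A P M} memP memA hA ↦ ?_⟩
  obtain ⟨i, B, hB, ⟨e⟩⟩ := h A
  exact (S.power i B hB).isPowerObject.map_of_iso (hF.power i B hB) hA e.symm

theorem IsLogical.isLogicalFrom {F : C ⥤ D} (hF : IsLogical F) (S : RankedToposStr C) :
    IsLogicalFrom S F :=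
  ⟨hF.regular, hF.nno, fun i A h ↦ hF.power _ _ (S.power i A h).isPowerObject⟩

theorem IsStrictLogical.isLogical {S : ToposStr C} {S' : ToposStr D} {F : C ⥤ D}
    (hF : IsStrictLogical S S' F) : IsLogical F :=
  hF.toRanked.isLogicalFrom.isLogical fun X ↦ ⟨0, X, trivial, ⟨Iso.refl X⟩⟩

theorem IsLogical.id : IsLogical (𝟭 C) := ⟨.id, fun _ _ h ↦ h, fun _ _ h ↦ h⟩

theorem IsLogical.comp {F : C ⥤ D} {G : D ⥤ E} (hF : IsLogical F) (hG : IsLogical G) :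
    IsLogical (F ⋙ G) :=
  ⟨hF.regular.comp hG.regular, fun _ _ h ↦ hG.nno _ _ (hF.nno _ _ h),
    fun _ _ h ↦ hG.power _ _ (hF.power _ _ h)⟩

end Logical

/-! ### Equalizers and initial objects -/

section Equalizer

variable {C : Type u₁} [Category.{v₁} C]

/-- This and the next lemmas say that the operations respect equality of arrows. They are needed
because two functors that agree on a map send it to maps between objects that are not definitionally
equal. -/
theorem arrow_mk_id_left {X Y X' Y' : C} {f : X ⟶ Y} {f' : X' ⟶ Y'}
    (h : Arrow.mk f = Arrow.mk f') : Arrow.mk (𝟙 X) = Arrow.mk (𝟙 X') :=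
  congrArg (fun a ↦ Arrow.mk (𝟙 a.left)) h

theorem arrow_mk_id_right {X Y X' Y' : C} {f : X ⟶ Y} {f' : X' ⟶ Y'}
    (h : Arrow.mk f = Arrow.mk f') : Arrow.mk (𝟙 Y) = Arrow.mk (𝟙 Y') :=
  congrArg (fun a ↦ Arrow.mk (𝟙 a.right)) h

theorem arrow_mk_comp {X Y Z X' Y' Z' : C} {f : X ⟶ Y} {g : Y ⟶ Z} {f' : X' ⟶ Y'} {g' : Y' ⟶ Z'}
    (h : Arrow.mk f = Arrow.mk f') (h' : Arrow.mk g = Arrow.mk g') :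
    Arrow.mk (f ≫ g) = Arrow.mk (f' ≫ g') := by
  cases h
  cases h'
  rfl

theorem arrow_mk_toTerminal {X W X' W' : C} (f : X ⟶ W) (f' : X' ⟶ W') (hW : IsTerminal W)
    (h : Arrow.mk (𝟙 X) = Arrow.mk (𝟙 X')) (h' : Arrow.mk (𝟙 W) = Arrow.mk (𝟙 W')) :
    Arrow.mk f = Arrow.mk f' := by
  obtain rfl : X = X' := congrArg Comma.left h
  obtain rfl : W = W' := congrArg Comma.left h'
  rw [hW.hom_ext f f']

theorem arrow_mk_lift {W X Y Z W' X' Y' Z' : C} {p : W ⟶ X} {q : W ⟶ Y} {p' : W' ⟶ X'}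
    {q' : W' ⟶ Y'} (l : Z ⟶ W) (l' : Z' ⟶ W') (hr : IsRelation p q)
    (hp : Arrow.mk p = Arrow.mk p') (hq : Arrow.mk q = Arrow.mk q')
    (ha : Arrow.mk (l ≫ p) = Arrow.mk (l' ≫ p')) (hb : Arrow.mk (l ≫ q) = Arrow.mk (l' ≫ q')) :
    Arrow.mk l = Arrow.mk l' := by
  obtain rfl : Z = Z' := congrArg Comma.left ha
  cases hp
  obtain rfl : Y = Y' := congrArg Comma.right hq
  obtain rfl := (Arrow.mk_inj _ _).1 hq
  rw [hr _ _ ((Arrow.mk_inj _ _).1 ha) ((Arrow.mk_inj _ _).1 hb)]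

theorem arrow_mk_recursor {T N X T' N' X' : C} {z : T ⟶ N} {s : N ⟶ N} {z' : T' ⟶ N'} {s' : N' ⟶ N'}
    (l : N ⟶ X) (l' : N' ⟶ X') {t : X ⟶ X} {t' : X' ⟶ X'} (hN : IsNNO z s)
    (hz : Arrow.mk z = Arrow.mk z') (hs : Arrow.mk s = Arrow.mk s') (ht : Arrow.mk t = Arrow.mk t')
    (ha : Arrow.mk (z ≫ l) = Arrow.mk (z' ≫ l')) (hl : s ≫ l = l ≫ t) (hl' : s' ≫ l' = l' ≫ t') :
    Arrow.mk l = Arrow.mk l' := by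
  cases hz
  obtain rfl := (Arrow.mk_inj _ _).1 hs
  obtain rfl : X = X' := congrArg Comma.left ht
  obtain rfl := (Arrow.mk_inj _ _).1 ht
  rw [(hN.2 _ _).unique ⟨rfl, hl⟩ ⟨((Arrow.mk_inj _ _).1 ha).symm, hl'⟩]

theorem arrow_mk_classifier {A P M B R A' P' M' B' R' : C} {memP : M ⟶ P} {memA : M ⟶ A}
    {r : R ⟶ B} {s : R ⟶ A} {χ : B ⟶ P} {memP' : M' ⟶ P'} {memA' : M' ⟶ A'} {r' : R' ⟶ B'}
    {s' : R' ⟶ A'} {χ' : B' ⟶ P'} (hP : IsPowerObject memP memA)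
    (hp : Arrow.mk memP = Arrow.mk memP') (ha : Arrow.mk memA = Arrow.mk memA')
    (hr : Arrow.mk r = Arrow.mk r') (hs : Arrow.mk s = Arrow.mk s')
    (hχ : Classifies memP memA r s χ) (hχ' : Classifies memP' memA' r' s' χ') :
    Arrow.mk χ = Arrow.mk χ' := by
  cases hp
  cases hr
  obtain rfl : A = A' := congrArg Comma.right ha
  obtain rfl := (Arrow.mk_inj _ _).1 ha
  obtain rfl := (Arrow.mk_inj _ _).1 hs
  rw [(hP.2 _ _ (hχ.isRelation hP.1)).unique hχ hχ']

theorem arrow_mk_power (S : RankedToposStr C) {i : ℕ} {A A' : C} (e : A = A') (h : S.rank i A)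
    (h' : S.rank i A') : Arrow.mk (S.power i A h).memPow = Arrow.mk (S.power i A' h').memPow ∧
      Arrow.mk (S.power i A h).memBase = Arrow.mk (S.power i A' h').memBase := by
  subst e
  exact ⟨rfl, rfl⟩

variable {D : Type u₂} [Category.{v₂} D]

/-- Strict functors commute with the operations, and the result of an operation is determined by its
arguments. -/
theorem isClosed_equalizer {S : RankedToposStr C} {S' : RankedToposStr D} {J : Type u}
    {F : J → (C ⥤ D)} (hF : ∀ j, IsStrictRankedLogical S S' (F j)) :
    IsClosed S (fun _ _ f ↦ ∀ j j', Arrow.mk ((F j).map f) = Arrow.mk ((F j').map f)) where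
  id_left f h j j' := by simpa using arrow_mk_id_left (h j j')
  id_right f h j j' := by simpa using arrow_mk_id_right (h j j')
  comp f g hf hg j j' := by simpa using arrow_mk_comp (hf j j') (hg j j')
  one hW j j' := by
    simpa using congrArg (fun X ↦ Arrow.mk (𝟙 X)) (((hF j).selOne hW).unique ((hF j').selOne hW))
  toTerminal f hW hX hW' j j' := arrow_mk_toTerminal _ _
    ((hF j).reg.isRegularFunctor.isTerminal hW.some).some (by simpa using hX j j')
    (by simpa using hW' j j')
  pb h hf hg := by
    simp only [← forall_and]
    exact fun j j' ↦ ((hF j).selPb h).unique ((hF j').selPb h) (hf j j') (hg j j')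
  lift l hr hp hq ha hb j j' := arrow_mk_lift _ _
    ((hF j).reg.isRegularFunctor.isRelation S.reg hr) (hp j j') (hq j j') (by simpa using ha j j')
    (by simpa using hb j j')
  im h hf := by
    simp only [← forall_and]
    exact fun j j' ↦ ((hF j).selIm h).unique ((hF j').selIm h) (hf j j')
  zero j j' := (hF j).nno.zero.trans (hF j').nno.zero.symm
  succ j j' := (hF j).nno.succ.trans (hF j').nno.succ.symm
  recursor l t ha ht hl j j' := arrow_mk_recursor _ _
    ((hF j).nno.preservesNNO _ _ S.nno.isNNO) ((hF j).nno.zero.trans (hF j').nno.zero.symm)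
    ((hF j).nno.succ.trans (hF j').nno.succ.symm) (ht j j') (by simpa using ha j j')
    (by rw [← Functor.map_comp, hl, Functor.map_comp])
    (by rw [← Functor.map_comp, hl, Functor.map_comp])
  power {i X} h hX := by
    simp only [← forall_and]
    intro j j'
    have e : (F j).obj X = (F j').obj X := congrArg Comma.left (hX j j')
    have := arrow_mk_power S' e ((hF j).rank i X h) ((hF j').rank i X h)
    exact ⟨(((hF j).power i X h).memPow.trans this.1).trans ((hF j').power i X h).memPow.symm,
      (((hF j).power i X h).memBase.trans this.2).trans ((hF j').power i X h).memBase.symm⟩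
  classifier {i X} h B R r s χ hr hs hχ j j' := by
    have e : (F j).obj X = (F j').obj X := congrArg Comma.right (hs j j')
    have := arrow_mk_power S' e ((hF j).rank i X h) ((hF j').rank i X h)
    exact arrow_mk_classifier ((hF j).isLogicalFrom.power i X h)
      ((((hF j).power i X h).memPow.trans this.1).trans ((hF j').power i X h).memPow.symm)
      ((((hF j).power i X h).memBase.trans this.2).trans ((hF j').power i X h).memBase.symm)
      (hr j j') (hs j j') (hχ.map (hF j).reg.isRegularFunctor)
      (hχ.map (hF j').reg.isRegularFunctor)

theorem exists_equalizer {K : Type w} [SmallCategory K] {S : RankedToposStr K}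
    {S' : RankedToposStr D} {J : Type u} {F : J → (K ⥤ D)}
    (hF : ∀ j, IsStrictRankedLogical S S' (F j)) :
    ∃ (R : StrRankedTopos.{w}) (V : R ⥤ K), IsStrictRankedLogical R.str S V ∧
      (∀ i X, S.rank i (V.obj X) → R.str.rank i X) ∧ Function.Injective V.obj ∧ V.Faithful ∧
        ∀ j j', V ⋙ F j = V ⋙ F j' := by
  obtain ⟨R, V, hV, hr, hi, hf, h⟩ :=
    IsClosed.exists_strRankedTopos.{w} (isClosed_equalizer hF)
  exact ⟨R, V, hV, fun i X ↦ (hr i X).2, hi, hf, fun j j' ↦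
    Arrow.functor_ext fun _ _ f ↦ h f j j'⟩

/-- Cancellation of functors that are injective on objects and on maps. -/
theorem functor_cancel {E : Type u₃} [Category.{v₃} E] {V : C ⥤ D} (hV : Function.Injective V.obj)
    [V.Faithful] {F G : E ⥤ C} (h : F ⋙ V = G ⋙ V) : F = G := by
  have hob (X : E) : F.obj X = G.obj X := hV (Functor.congr_obj h X)
  refine CategoryTheory.Functor.ext hob fun X Y f ↦ V.map_injective ?_
  simpa [eqToHom_map] using Functor.congr_hom h f

/-- An initial object from a weakly initial one and equalizers. -/
theorem exists_isInitial {𝒞 : Type u₁} [Category.{v₁} 𝒞] (hW : ∃ W : 𝒞, ∀ X, Nonempty (W ⟶ X))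
    (hE : ∀ {J : Type v₁} {X Y : 𝒞} (f : J → (X ⟶ Y)), ∃ (Q : 𝒞) (i : Q ⟶ X), Mono i ∧
      ∀ j j', i ≫ f j = i ≫ f j') : ∃ Q : 𝒞, Nonempty (IsInitial Q) := by
  obtain ⟨W, hW⟩ := hW
  -- `Q` equalises all endomorphisms of `W`. Only the monicity and the equalising property of `i`
  -- are used, not a universal property.
  obtain ⟨Q, i, _, hi⟩ := hE (fun f : W ⟶ W ↦ f)
  refine ⟨Q, ⟨IsInitial.ofUniqueHom (fun X ↦ i ≫ (hW X).some) fun X f ↦ ?_⟩⟩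
  obtain ⟨Z, e, _, he⟩ := hE (fun j : ULift.{v₁} Bool ↦ cond j.down f (i ≫ (hW X).some))
  -- The loop `W ⟶ Z ⟶ Q ⟶ W` agrees with the identity after `i`. Thus `e` is a split epimorphism,
  -- which forces the two maps that it equalises to coincide.
  have h₁ : i ≫ (hW Z).some ≫ e = 𝟙 Q := by
    rw [← cancel_mono i]
    simpa using hi ((hW Z).some ≫ e ≫ i) (𝟙 W)
  have h₂ : e ≫ f = e ≫ i ≫ (hW X).some := he ⟨true⟩ ⟨false⟩
  rw [← Category.id_comp f, ← h₁, Category.assoc, Category.assoc, h₂, reassoc_of% h₁]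

theorem exists_isFreeRankedTopos : ∃ R : StrRankedTopos.{w}, IsFreeRankedTopos R := by
  refine exists_isInitial ?_ fun {J X Y} f ↦ ?_
  · obtain ⟨R, V, hV, -⟩ := exists_strRankedTopos_family.{w} fun X : StrRankedTopos.{w} ↦ X.str
    exact ⟨R, fun X ↦ ⟨⟨V X, hV X⟩⟩⟩
  · obtain ⟨R, V, hV, -, hi, hf, h⟩ := exists_equalizer fun j ↦ (f j).2
    exact ⟨R, ⟨V, hV⟩, ⟨fun F G hFG ↦ Subtype.ext (functor_cancel hi (congrArg Subtype.val hFG))⟩,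
      fun j j' ↦ Subtype.ext (h j j')⟩

/-- The constructions are carried out for `∞`-ranked toposes with all objects of rank `0`; the
clauses on rank return toposes. -/
theorem exists_isFreeTopos : ∃ T : StrTopos.{w}, IsFreeTopos T := by
  refine exists_isInitial ?_ fun {J X Y} f ↦ ?_
  · obtain ⟨R, V, hV, hr⟩ :=
      exists_strRankedTopos_family.{w} fun X : StrTopos.{w} ↦ X.str.toRanked
    exact ⟨⟨R, R.str.toTopos fun X ↦ hr 0 X fun _ ↦ trivial⟩, fun X ↦ ⟨⟨V X, (hV X).toTopos _⟩⟩⟩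
  · obtain ⟨R, V, hV, hr, hi, hf, h⟩ := exists_equalizer fun j ↦ (f j).2.toRanked
    exact ⟨⟨R, R.str.toTopos fun X ↦ hr 0 X trivial⟩, ⟨V, hV.toTopos _⟩,
      ⟨fun F G hFG ↦ Subtype.ext (functor_cancel hi (congrArg Subtype.val hFG))⟩,
      fun j j' ↦ Subtype.ext (h j j')⟩

end Equalizer

/-! ### Induction over the objects of a free topos -/

section Induction

/-- A class of objects that contains everything that can be constructed from its members. -/
structure IsInductive {C : Type u₁} [Category.{v₁} C] (S : RankedToposStr C)
    (Q : ObjectProperty C) : Prop where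
  terminal : ∀ {W : C}, IsTerminal W → Q W
  pullback : ∀ {W X Y Z : C} {p : W ⟶ X} {q : W ⟶ Y} {f : X ⟶ Z} {g : Y ⟶ Z},
    IsPullback p q f g → Q X → Q Y → Q Z → Q W
  image : ∀ {X I Y : C} {e : X ⟶ I} {m : I ⟶ Y}, Mono m → IsCover e → Q X → Q Y → Q I
  nat : Q S.nno.nat
  power : ∀ {i} {X : C} (h : S.rank i X), Q X → Q (S.power i X h).pow ∧ Q (S.power i X h).mem

theorem IsInductive.isClosed {C : Type u₁} [Category.{v₁} C] {S : RankedToposStr C}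
    {Q : ObjectProperty C} (hQ : IsInductive S Q) : IsClosed S (fun X Y _ ↦ Q X ∧ Q Y) where
  id_left _ h := ⟨h.1, h.1⟩
  id_right _ h := ⟨h.2, h.2⟩
  comp _ _ h h' := ⟨h.1, h'.2⟩
  one h := have := hQ.terminal h.isTerminal.some; ⟨this, this⟩
  toTerminal _ _ h h' := ⟨h.1, h'.1⟩
  pb h hf hg := have := hQ.pullback h.isPullback hf.1 hg.1 hf.2; ⟨⟨this, hf.1⟩, this, hg.1⟩
  lift _ _ hp _ ha _ := ⟨ha.1, hp.1⟩
  im h hf :=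
    have := hQ.image h.mono h.isCover hf.1 hf.2
    ⟨⟨hf.1, this⟩, this, hf.2⟩
  zero := ⟨hQ.terminal S.reg.isTerminal, hQ.nat⟩
  succ := ⟨hQ.nat, hQ.nat⟩
  recursor _ _ _ ht _ := ⟨hQ.nat, ht.1⟩
  power h hX := have := hQ.power h hX.1; ⟨this.symm, this.2, hX.1⟩
  classifier h _ _ _ _ _ hr hs _ := ⟨hr.2, (hQ.power h hs.2).1⟩

/-- The part of initiality that is common to free toposes and to free `∞`-ranked toposes. -/
def IsRigid {C : Type w} [SmallCategory C] (S : RankedToposStr C) : Prop :=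
  ∀ P : StrRankedTopos.{w}, ((∀ i X, S.rank i X) → ∀ i X, P.str.rank i X) →
    ∃ s : C ⥤ P, ∀ V : P ⥤ C, IsStrictRankedLogical P.str S V → s ⋙ V = 𝟭 C

/-- The initial map to `P` followed by `V` is an endomorphism of an initial object. -/
theorem IsFreeRankedTopos.isRigid {R : StrRankedTopos.{w}} (hR : IsFreeRankedTopos R) :
    IsRigid R.str := by
  obtain ⟨hR⟩ := hR
  exact fun P _ ↦ ⟨(hR.to P).1, fun V hV ↦
    congrArg Subtype.val (hR.hom_ext (hR.to P ≫ (⟨V, hV⟩ : P ⟶ R)) (𝟙 R))⟩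

theorem IsFreeTopos.isRigid {T : StrTopos.{w}} (hT : IsFreeTopos T) : IsRigid T.str.toRanked := by
  obtain ⟨hT⟩ := hT
  intro P hP
  let P' : StrTopos.{w} := ⟨P, P.str.toTopos fun X ↦ hP (fun _ _ ↦ trivial) 0 X⟩
  exact ⟨(hT.to P').1, fun V hV ↦
    congrArg Subtype.val (hT.hom_ext (hT.to P' ≫ (⟨V, hV.toTopos _⟩ : P' ⟶ T)) (𝟙 T))⟩

/-- The full subcategory on `Q` is a substructure whose inclusion has a section, so every object
lies in it. -/
theorem IsRigid.induction {C : Type w} [SmallCategory C] {S : RankedToposStr C} (hS : IsRigid S)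
    {Q : ObjectProperty C} (hQ : IsInductive S Q) (X : C) : Q X := by
  obtain ⟨P, V, hV, hr, -, -, h⟩ := IsClosed.exists_strRankedTopos.{w} hQ.isClosed
  obtain ⟨s, hs⟩ := hS P fun H i X ↦ (hr i X).2 (H i _)
  have hX : (s ⋙ V).obj X = X := Functor.congr_obj (hs V hV) X
  rw [← hX]
  exact (h (𝟙 (s.obj X))).1

end Induction

/-! ### Logical functors out of a free topos are uniquely isomorphic -/

section IsoComma

variable {C : Type u₁} [Category.{v₁} C] {E : Type u₂} [Category.{v₂} E] {S : RankedToposStr C}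
  {F G : C ⥤ E}

theorem Classifies.precomp {A P M B R B' R' : C} {memP : M ⟶ P} {memA : M ⟶ A} {r : R ⟶ B}
    {s : R ⟶ A} {χ : B ⟶ P} (h : Classifies memP memA r s χ) {r' : R' ⟶ B'} (ρ : R' ≅ R)
    (b : B' ≅ B) (hr : r' ≫ b.hom = ρ.hom ≫ r) :
    Classifies memP memA r' (ρ.hom ≫ s) (b.hom ≫ χ) := by
  obtain ⟨k, hk, rfl⟩ := h
  exact ⟨ρ.hom ≫ k, hk.of_iso ρ.symm (Iso.refl _) b.symm (Iso.refl _) (by simp)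
    (by simp [Iso.eq_inv_comp, ← reassoc_of% hr]) (by simp) (by simp), by simp⟩

/-- The two projections of the category of triples `(X, Y, F X ≅ G Y)`. -/
def isoCommaProj (F G : C ⥤ E) (b : Bool) : CategoricalPullback F G ⥤ C :=
  bif b then CategoricalPullback.π₂ F G else CategoricalPullback.π₁ F G

/-- Chosen limits and images are taken separately in the two copies of `C`. Since `F` and `G`
preserve them, the given isomorphisms in `E` induce the isomorphism required on the results. -/
theorem jointlyCreatesRegs_isoComma (R : RegularStr E) (hF : IsRegularFunctor F)
    (hG : IsRegularFunctor G) : JointlyCreatesRegs (isoCommaProj F G) fun _ ↦ S where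
  faithful f g h := CategoricalPullback.hom_ext (h false) (h true)
  conservative f h := (CategoricalPullback.isIso_iff F G f).2 ⟨h false, h true⟩
  one k := by
    obtain ⟨W, hW⟩ := S.exists_selOne k
    obtain ⟨hT⟩ := hW.isTerminal
    obtain ⟨hFT⟩ := hF.isTerminal hT
    obtain ⟨hGT⟩ := hG.isTerminal hT
    exact ⟨⟨W, W, hFT.uniqueUpToIso hGT⟩, ⟨IsTerminal.ofUniqueHom
      (fun X ↦ ⟨hT.from _, hT.from _, hGT.hom_ext _ _⟩)
      fun _ _ ↦ CategoricalPullback.hom_ext (hT.hom_ext _ _) (hT.hom_ext _ _)⟩,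
      Bool.forall_bool.2 ⟨hW, hW⟩⟩
  pb k X Y Z f g hX hY hZ := by
    obtain ⟨W₁, p₁, q₁, h₁⟩ := S.exists_selPb k f.fst g.fst (hX false) (hY false) (hZ false)
    obtain ⟨W₂, p₂, q₂, h₂⟩ := S.exists_selPb k f.snd g.snd (hX true) (hY true) (hZ true)
    have H₂ := hG.isPullback h₂.isPullback
    have H₁ := (hF.isPullback h₁.isPullback).of_iso (Iso.refl _) X.iso Y.iso Z.iso
      (fst' := F.map p₁ ≫ X.iso.hom) (snd' := F.map q₁ ≫ Y.iso.hom) (by simp) (by simp) f.w g.w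
    let φ := H₁.isoIsPullback _ _ H₂
    have hφ₁ : φ.hom ≫ G.map p₂ = F.map p₁ ≫ X.iso.hom := H₁.isoIsPullback_hom_fst _ _ H₂
    have hφ₂ : φ.hom ≫ G.map q₂ = F.map q₁ ≫ Y.iso.hom := H₁.isoIsPullback_hom_snd _ _ H₂
    let p : (⟨W₁, W₂, φ⟩ : CategoricalPullback F G) ⟶ X := ⟨p₁, p₂, hφ₁.symm⟩
    let q : (⟨W₁, W₂, φ⟩ : CategoricalPullback F G) ⟶ Y := ⟨q₁, q₂, hφ₂.symm⟩
    refine ⟨_, p, q, .mk' (CategoricalPullback.hom_ext h₁.isPullback.w h₂.isPullback.w)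
      (fun T a b ha hb ↦ CategoricalPullback.hom_ext
        (h₁.isPullback.hom_ext (congrArg CategoricalPullback.Hom.fst ha)
          (congrArg CategoricalPullback.Hom.fst hb))
        (h₂.isPullback.hom_ext (congrArg CategoricalPullback.Hom.snd ha)
          (congrArg CategoricalPullback.Hom.snd hb))) (fun T a b hab ↦ ?_),
      Bool.forall_bool.2 ⟨h₁, h₂⟩⟩
    obtain ⟨l₁, hl₁, hl₁'⟩ := h₁.isPullback.exists_lift a.fst b.fst
      (congrArg CategoricalPullback.Hom.fst hab)
    obtain ⟨l₂, hl₂, hl₂'⟩ := h₂.isPullback.exists_lift a.snd b.snd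
      (congrArg CategoricalPullback.Hom.snd hab)
    refine ⟨⟨l₁, l₂, H₂.hom_ext ?_ ?_⟩, CategoricalPullback.hom_ext hl₁ hl₂,
      CategoricalPullback.hom_ext hl₁' hl₂'⟩
    · rw [Category.assoc, Category.assoc, hφ₁, ← Functor.map_comp_assoc, ← Functor.map_comp, hl₁,
        hl₂, a.w]
    · rw [Category.assoc, Category.assoc, hφ₂, ← Functor.map_comp_assoc, ← Functor.map_comp, hl₁',
        hl₂', b.w]
  im k X Y f hX hY := by
    obtain ⟨I₁, e₁, m₁, h₁⟩ := S.exists_selIm k f.fst (hX false) (hY false)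
    obtain ⟨I₂, e₂, m₂, h₂⟩ := S.exists_selIm k f.snd (hX true) (hY true)
    have := R.hasPullbacks
    have := h₁.mono
    have := h₂.mono
    have := hF.mono m₁
    have := hG.mono m₂
    obtain ⟨θ, hθ, hθ'⟩ := exists_iso_of_fac (m := F.map m₁ ≫ Y.iso.hom) (m' := G.map m₂)
      (hF.map_cover _ h₁.isCover) ((hG.map_cover _ h₂.isCover).isIso_comp X.iso.hom)
      (by rw [← Functor.map_comp_assoc, h₁.fac, Category.assoc, ← Functor.map_comp, h₂.fac, f.w])
    exact ⟨⟨I₁, I₂, θ⟩, ⟨e₁, e₂, hθ⟩, ⟨m₁, m₂, hθ'.symm⟩,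
      CategoricalPullback.hom_ext h₁.fac h₂.fac, Bool.forall_bool.2 ⟨h₁, h₂⟩⟩

theorem jointlyCreates_isoComma (R : RegularStr E) (hF : IsLogicalFrom S F)
    (hG : IsLogicalFrom S G) : JointlyCreates (isoCommaProj F G) fun _ ↦ S where
  toJointlyCreatesRegs := jointlyCreatesRegs_isoComma R hF.regular hG.regular
  nno T hT h := by
    obtain ⟨T₁, T₂, φ⟩ := T
    obtain rfl : T₁ = S.reg.one := h false
    obtain rfl : T₂ = S.reg.one := h true
    have regs := jointlyCreatesRegs_isoComma (S := S) R hF.regular hG.regular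
    have HF := hF.nno _ _ S.nno.isNNO
    have HG := hG.nno _ _ S.nno.isNNO
    obtain ⟨t, n, hz, hs⟩ := HF.unique_iso HG
    -- Isomorphisms between terminal objects are unique.
    obtain rfl : t = φ := Iso.ext (HG.1.some.hom_ext _ _)
    let z : (⟨_, _, t⟩ : CategoricalPullback F G) ⟶ ⟨S.nno.nat, S.nno.nat, n⟩ :=
      ⟨S.nno.zero, S.nno.zero, hz⟩
    let s : (⟨_, _, n⟩ : CategoricalPullback F G) ⟶ ⟨S.nno.nat, S.nno.nat, n⟩ :=
      ⟨S.nno.succ, S.nno.succ, hs⟩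
    refine ⟨_, z, s, regs.reg.isNNO hT
      (Bool.forall_bool.2 ⟨S.nno.isNNO, S.nno.isNNO⟩) (fun {X} a r l hl ↦ ?_),
      Bool.forall_bool.2 ⟨⟨rfl, rfl⟩, rfl, rfl⟩⟩
    obtain ⟨l₁, e₁⟩ : ∃ l₁ : S.nno.nat ⟶ X.fst, l₁ = l false := ⟨_, rfl⟩
    obtain ⟨l₂, e₂⟩ : ∃ l₂ : S.nno.nat ⟶ X.snd, l₂ = l true := ⟨_, rfl⟩
    have h₁ : S.nno.zero ≫ l₁ = a.fst ∧ S.nno.succ ≫ l₁ = l₁ ≫ r.fst := e₁ ▸ hl false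
    have h₂ : S.nno.zero ≫ l₂ = a.snd ∧ S.nno.succ ≫ l₂ = l₂ ≫ r.snd := e₂ ▸ hl true
    have ha : F.map a.fst ≫ X.iso.hom = t.hom ≫ G.map a.snd := a.w
    have w : F.map l₁ ≫ X.iso.hom = n.hom ≫ G.map l₂ := by
      -- Both sides solve the same recursion problem out of the natural numbers object `F N`.
      refine (HF.2 (F.map a.fst ≫ X.iso.hom) (G.map r.snd)).unique ⟨?_, ?_⟩ ⟨?_, ?_⟩
      · rw [← Functor.map_comp_assoc, h₁.1]
      · rw [← Functor.map_comp_assoc, h₁.2, Functor.map_comp_assoc, r.w, Category.assoc]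
      · rw [reassoc_of% hz, ← Functor.map_comp, h₂.1, ha]
      · rw [reassoc_of% hs, ← Functor.map_comp, h₂.2, Functor.map_comp, Category.assoc]
    exact ⟨⟨l₁, l₂, w⟩, Bool.forall_bool.2 ⟨e₁, e₂⟩⟩
  power i A h := by
    have regs := jointlyCreatesRegs_isoComma (S := S) R hF.regular hG.regular
    have hA₁ : S.rank i A.fst := h false
    have hA₂ : S.rank i A.snd := h true
    have H₁ := hF.power i _ hA₁
    have H₂ := hG.power i _ hA₂
    obtain ⟨p, m, hp, ha⟩ := H₁.exists_iso H₂ A.iso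
    let memP : (⟨_, _, m⟩ : CategoricalPullback F G) ⟶ ⟨_, _, p⟩ := ⟨_, _, hp⟩
    let memA : (⟨_, _, m⟩ : CategoricalPullback F G) ⟶ A := ⟨_, _, ha⟩
    refine ⟨⟨_, _, memP, memA, regs.reg.isPowerObject (Bool.forall_bool.2
      ⟨(S.power i _ hA₁).isPowerObject, (S.power i _ hA₂).isPowerObject⟩) (fun {Z} x y l hl ↦ ?_)
      (fun {B R} r s χ hχ ↦ ?_)⟩, fun b _ ↦ by cases b <;> exact ⟨rfl, rfl⟩⟩
    · obtain ⟨l₁, e₁⟩ : ∃ l₁ : Z.fst ⟶ (S.power i _ hA₁).mem, l₁ = l false := ⟨_, rfl⟩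
      obtain ⟨l₂, e₂⟩ : ∃ l₂ : Z.snd ⟶ (S.power i _ hA₂).mem, l₂ = l true := ⟨_, rfl⟩
      have h₁ : l₁ ≫ (S.power i _ hA₁).memPow = x.fst ∧ l₁ ≫ (S.power i _ hA₁).memBase = y.fst :=
        e₁ ▸ hl false
      have h₂ : l₂ ≫ (S.power i _ hA₂).memPow = x.snd ∧ l₂ ≫ (S.power i _ hA₂).memBase = y.snd :=
        e₂ ▸ hl true
      have hx : F.map x.fst ≫ p.hom = Z.iso.hom ≫ G.map x.snd := x.w
      have w : F.map l₁ ≫ m.hom = Z.iso.hom ≫ G.map l₂ := by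
        refine H₂.1 _ _ ?_ ?_
        · rw [Category.assoc, ← hp, ← Functor.map_comp_assoc, Category.assoc, ← Functor.map_comp,
            h₁.1, h₂.1, hx]
        · rw [Category.assoc, ← ha, ← Functor.map_comp_assoc, Category.assoc, ← Functor.map_comp,
            h₁.2, h₂.2, y.w]
      exact ⟨⟨l₁, l₂, w⟩, Bool.forall_bool.2 ⟨e₁, e₂⟩⟩
    · have h₁ : Classifies _ _ r.fst s.fst (χ false) := hχ false
      have h₂ : Classifies _ _ r.snd s.snd (χ true) := hχ true
      have h₁' := (h₁.map hF.regular).of_iso A.iso p m hp ha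
      have h₂' := (h₂.map hG.regular).precomp R.iso B.iso r.w
      rw [← s.w] at h₂'
      -- The square commutes because both composites classify the same relation in `E`.
      exact ⟨⟨χ false, χ true, (H₂.2 _ _ (h₁'.isRelation H₂.1)).unique h₁' h₂'⟩,
        Bool.forall_bool.2 ⟨rfl, rfl⟩⟩

end IsoComma

section Contractible

variable {C : Type w} [SmallCategory C] {S : RankedToposStr C} {E : Type u} [Category.{w} E]
  {F G : C ⥤ E}

theorem IsRigid.nonempty_iso (hS : IsRigid S) (R : RegularStr E) (hF : IsLogicalFrom S F)
    (hG : IsLogicalFrom S G) : Nonempty (F ≅ G) := by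
  obtain ⟨S', hS', hr⟩ := (jointlyCreates_isoComma R hF hG).exists_rankedToposStr
  -- The category of triples is small because `E` is locally small. The one `s` is a section of both
  -- projections, so its third components form a natural isomorphism.
  obtain ⟨s, hs⟩ := hS ⟨_, S'⟩ fun H i X ↦ (hr i X).2 fun _ ↦ H i _
  have h₁ : s ⋙ CategoricalPullback.π₁ F G = 𝟭 C := hs _ (hS' false)
  have h₂ : s ⋙ CategoricalPullback.π₂ F G = 𝟭 C := hs _ (hS' true)
  have : Nonempty ((s ⋙ CategoricalPullback.π₁ F G) ⋙ F ≅ (s ⋙ CategoricalPullback.π₂ F G) ⋙ G) :=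
    ⟨Functor.isoWhiskerLeft s (CatCommSq.iso (CategoricalPullback.π₁ F G)
      (CategoricalPullback.π₂ F G) F G)⟩
  rwa [h₁, h₂] at this

/-- By naturality, a component at a constructed object is determined by the components at its
constituents. -/
theorem isInductive_app_eq (hF : IsLogicalFrom S F) (hG : IsLogicalFrom S G) (α β : F ≅ G) :
    IsInductive S fun X ↦ α.hom.app X = β.hom.app X where
  terminal hW := (hG.regular.isTerminal hW).some.hom_ext _ _
  pullback h hX hY hZ := (hG.regular.isPullback h).hom_ext
    (by rw [← α.hom.naturality, ← β.hom.naturality, hX])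
    (by rw [← α.hom.naturality, ← β.hom.naturality, hY])
  image {_ _ _ e m} _ _ _ hY := by
    have := hG.regular.mono m
    rw [← cancel_mono (G.map m), ← α.hom.naturality, ← β.hom.naturality, hY]
  nat := by
    obtain ⟨hT⟩ := hG.regular.isTerminal S.reg.isTerminal
    refine ((hF.nno _ _ S.nno.isNNO).2 (α.hom.app _ ≫ G.map S.nno.zero) (G.map S.nno.succ)).unique
      ⟨α.hom.naturality _, α.hom.naturality _⟩ ⟨?_, β.hom.naturality _⟩
    rw [hT.hom_ext (α.hom.app S.reg.one) (β.hom.app S.reg.one)]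
    exact β.hom.naturality _
  power {i X} h hX := by
    have H := hG.power i X h
    -- The component at the power-object classifies a relation that depends only on the component at
    -- `X`.
    have key (γ : F ≅ G) (hγ : γ.hom.app X = α.hom.app X) :
        Classifies (G.map (S.power i X h).memPow) (G.map (S.power i X h).memBase)
          (F.map (S.power i X h).memPow) (F.map (S.power i X h).memBase ≫ α.hom.app X)
          (γ.hom.app (S.power i X h).pow) :=
      ⟨γ.hom.app _, .of_horiz_isIso ⟨(γ.hom.naturality _).symm⟩, by
        rw [← γ.hom.naturality, hγ]⟩
    have h₁ : α.hom.app (S.power i X h).pow = β.hom.app (S.power i X h).pow :=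
      (H.2 _ _ ((key α rfl).isRelation H.1)).unique (key α rfl) (key β hX.symm)
    refine ⟨h₁, H.1 _ _ ?_ ?_⟩
    · rw [← α.hom.naturality, ← β.hom.naturality, h₁]
    · rw [← α.hom.naturality, ← β.hom.naturality, hX]

/-- Any two logical functors out of a free topos are uniquely isomorphic. -/
theorem IsRigid.nonempty_unique_iso (hS : IsRigid S) (R : RegularStr E) (hF : IsLogicalFrom S F)
    (hG : IsLogicalFrom S G) : Nonempty (Unique (F ≅ G)) := by
  obtain ⟨α⟩ := hS.nonempty_iso R hF hG
  exact ⟨⟨⟨α⟩, fun β ↦ Iso.ext (NatTrans.ext (funext fun X ↦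
    hS.induction (isInductive_app_eq hF hG β α) X))⟩⟩

end Contractible

/-! ### Objects of bounded rank, up to isomorphism -/

section IsoRanked

variable {C : Type u₁} [Category.{v₁} C]

/-- For terminal `A`, membership is the subobject classifier `true : 1 ⟶ Ω`. Any map `a` into `M`
makes `a ≫ memP` classify the maximal subobject, so exactly one such map exists. -/
theorem IsPowerObject.isTerminal {A P M : C} {memP : M ⟶ P} {memA : M ⟶ A}
    (h : IsPowerObject memP memA) (hA : IsTerminal A) : Nonempty (IsTerminal M) := by
  have hm {Z : C} (a b : Z ⟶ M) (hab : a ≫ memP = b ≫ memP) : a = b :=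
    h.1 a b hab (hA.hom_ext _ _)
  have hr (Z : C) : IsRelation (𝟙 Z) (hA.from Z) := fun _ a b hab _ ↦ by simpa using hab
  have key {Z : C} (a : Z ⟶ M) : Classifies memP memA (𝟙 Z) (hA.from Z) (a ≫ memP) :=
    ⟨a, .mk' (by simp) (fun _ _ _ _ hab ↦ by simpa using hab)
      (fun _ c d hcd ↦ ⟨d, hm _ _ (by simpa using hcd.symm), by simp⟩), hA.hom_ext _ _⟩
  exact ⟨IsTerminal.ofUniqueHom (fun Z ↦ (h.2 _ _ (hr Z)).choose_spec.1.choose)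
    fun Z a ↦ hm _ _ ((h.2 _ _ (hr Z)).unique (key _) (key _))⟩

variable (S : RankedToposStr C)

/-- The objects that are isomorphic to one of rank `i`. -/
def RankedToposStr.isoRank (i : ℕ) : ObjectProperty C := fun X ↦ ∃ Y, S.rank i Y ∧ Nonempty (X ≅ Y)

variable {S} {i : ℕ}

theorem RankedToposStr.isoRank_of_rank {X : C} (h : S.rank i X) : S.isoRank i X :=
  ⟨X, h, ⟨Iso.refl X⟩⟩

theorem RankedToposStr.isoRank_mono : Monotone S.isoRank :=
  monotone_nat_of_le_succ fun i _ ⟨Y, hY, e⟩ ↦ ⟨Y, S.rank_mono i Y hY, e⟩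

theorem RankedToposStr.isoRank_terminal {W : C} (hW : IsTerminal W) : S.isoRank i W := by
  obtain ⟨T, hT⟩ := S.exists_selOne (some i)
  exact ⟨T, hT.inRank, ⟨hW.uniqueUpToIso hT.isTerminal.some⟩⟩

theorem RankedToposStr.isoRank_pullback {W X Y Z : C} {p : W ⟶ X} {q : W ⟶ Y} {f : X ⟶ Z}
    {g : Y ⟶ Z} (h : IsPullback p q f g) (hX : S.isoRank i X) (hY : S.isoRank i Y)
    (hZ : S.isoRank i Z) : S.isoRank i W := by
  obtain ⟨X', hX, ⟨x⟩⟩ := hX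
  obtain ⟨Y', hY, ⟨y⟩⟩ := hY
  obtain ⟨Z', hZ, ⟨z⟩⟩ := hZ
  obtain ⟨W', p', q', h'⟩ := S.exists_selPb (some i) (x.inv ≫ f ≫ z.hom) (y.inv ≫ g ≫ z.hom)
    hX hY hZ
  have H := h.of_iso (Iso.refl _) x y z (fst' := p ≫ x.hom) (snd' := q ≫ y.hom)
    (f' := x.inv ≫ f ≫ z.hom) (g' := y.inv ≫ g ≫ z.hom) (by simp) (by simp) (by simp) (by simp)
  exact ⟨W', h'.inRank, ⟨H.isoIsPullback _ _ h'.isPullback⟩⟩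

theorem RankedToposStr.isoRank_image {X I Y : C} {e : X ⟶ I} {m : I ⟶ Y} (hm : Mono m)
    (he : IsCover e) (hX : S.isoRank i X) (hY : S.isoRank i Y) : S.isoRank i I := by
  obtain ⟨X', hX, ⟨x⟩⟩ := hX
  obtain ⟨Y', hY, ⟨y⟩⟩ := hY
  obtain ⟨I', e', m', h'⟩ := S.exists_selIm (some i) (x.inv ≫ e ≫ m ≫ y.hom) hX hY
  have := S.reg.hasPullbacks
  have := h'.mono
  obtain ⟨θ, -⟩ := exists_iso_of_fac (m := m ≫ y.hom) (m' := m') he (h'.isCover.isIso_comp x.hom)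
    (by simp [h'.fac])
  exact ⟨I', h'.inRank, ⟨θ⟩⟩

/-- Membership relations are subobjects of products, hence pullbacks of the subobject classifier. -/
theorem RankedToposStr.isoRank_mem {X : C} (h : S.rank i X) :
    S.isoRank (i + 1) (S.power i X h).mem := by
  have hP := isoRank_of_rank (S.power_mem i X h)
  -- Taking the terminal object in rank `i` gives `Ω` rank `i + 1`, the same as the power-object of
  -- `X`.
  obtain ⟨T, hT⟩ := S.exists_selOne (some i)
  obtain ⟨hT'⟩ := hT.isTerminal
  have H := (S.power i T hT.inRank).isPowerObject
  have hQ := S.reg.isPullback (hT'.from (S.power i X h).pow) (hT'.from X)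
  obtain ⟨m, hm, hm'⟩ := hQ.exists_lift (S.power i X h).memPow (S.power i X h).memBase
    (hT'.hom_ext _ _)
  have hr : IsRelation m (hT'.from _) := fun _ a b hab _ ↦
    (S.power i X h).isPowerObject.1 _ _ (by rw [← hm, reassoc_of% hab])
      (by rw [← hm', reassoc_of% hab])
  obtain ⟨χ, ⟨k, hk, -⟩, -⟩ := H.2 _ _ hr
  exact isoRank_pullback hk (isoRank_terminal (H.isTerminal hT').some)
    (isoRank_pullback hQ hP (isoRank_mono i.le_succ _ (isoRank_of_rank h)) (isoRank_terminal hT'))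
    (isoRank_of_rank (S.power_mem i T hT.inRank))

/-- Finitely many ranks have a common bound, within which pullbacks and images can be formed. -/
theorem RankedToposStr.isInductive_isoRank (S : RankedToposStr C) :
    IsInductive S fun X ↦ ∃ i, S.isoRank i X where
  terminal hW := ⟨0, isoRank_terminal hW⟩
  pullback := by
    rintro _ _ _ _ _ _ _ _ h ⟨i, hX⟩ ⟨j, hY⟩ ⟨k, hZ⟩
    exact ⟨i ⊔ j ⊔ k, isoRank_pullback h
      (isoRank_mono (le_sup_left.trans le_sup_left) _ hX)
      (isoRank_mono (le_sup_right.trans le_sup_left) _ hY) (isoRank_mono le_sup_right _ hZ)⟩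
  image := by
    rintro _ _ _ _ _ hm he ⟨i, hX⟩ ⟨j, hY⟩
    exact ⟨i ⊔ j, isoRank_image hm he (isoRank_mono le_sup_left _ hX)
      (isoRank_mono le_sup_right _ hY)⟩
  nat := ⟨0, isoRank_of_rank (S.nat_mem 0)⟩
  power {i X} h _ := ⟨⟨i + 1, isoRank_of_rank (S.power_mem i X h)⟩, i + 1, isoRank_mem h⟩

theorem RankedToposStr.isTopos (S : RankedToposStr C) (h : ∀ X, ∃ i, S.isoRank i X) :
    IsTopos C := by
  choose i Y hY e using h
  exact ⟨⟨S.reg, S.nno, fun X ↦ ⟨_, _, (S.power (i X) (Y X) (hY X)).memPow,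
    (S.power (i X) (Y X) (hY X)).memBase ≫ (e X).some.inv,
    (S.power (i X) (Y X) (hY X)).isPowerObject.of_iso (e X).some.symm (Iso.refl _) (Iso.refl _)
      (by simp) (by simp)⟩⟩⟩

end IsoRanked

/-! ### Universal properties of the free topos and of the free `∞`-ranked topos -/

section Free

variable {T : StrTopos.{w}} {R : StrRankedTopos.{w}}

/-- Initiality speaks only of small toposes, so `E` is replaced by a small topos with a strict
functor to it. -/
theorem IsFreeTopos.exists_isLogical (hT : IsFreeTopos T) {E : Type u} [Category.{w} E]
    (hE : IsTopos E) : ∃ F : T ⥤ E, IsLogical F := by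
  obtain ⟨hT⟩ := hT
  obtain ⟨S⟩ := hE
  obtain ⟨P, V, hV, hr⟩ := exists_strRankedTopos_family.{w} fun _ : PUnit.{1} ↦ S.toRanked
  let P' : StrTopos.{w} := ⟨P, P.str.toTopos fun X ↦ hr 0 X fun _ ↦ trivial⟩
  exact ⟨(hT.to P').1 ⋙ V ⟨⟩, ((hT.to P').2.comp ((hV ⟨⟩).toTopos _)).isLogical⟩

theorem IsFreeTopos.isBiInitialTopos (hT : IsFreeTopos T) : IsBiInitialTopos.{u, w} T :=
  ⟨⟨T.str⟩, fun _ _ hE ↦ ⟨hT.exists_isLogical hE, fun _ _ hF hG ↦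
    hT.isRigid.nonempty_unique_iso hE.some.reg (hF.isLogicalFrom _) (hG.isLogicalFrom _)⟩⟩

theorem IsFreeRankedTopos.exists_isoRank (hR : IsFreeRankedTopos R) (X : R) :
    ∃ i, R.str.isoRank i X :=
  hR.isRigid.induction R.str.isInductive_isoRank X

theorem IsFreeRankedTopos.isTopos (hR : IsFreeRankedTopos R) : IsTopos R :=
  R.str.isTopos hR.exists_isoRank

/-- `F` is isomorphic to a strict functor, which preserves rank on the nose. -/
theorem IsFreeRankedTopos.preservesRank (hR : IsFreeRankedTopos R) {E : Type u} [Category.{w} E]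
    (S : RankedToposStr E) {F : R ⥤ E} (hF : IsLogicalFrom R.str F) :
    PreservesRank R.str S F := by
  obtain ⟨P, V, hV, -⟩ := exists_strRankedTopos_family.{w} fun _ : PUnit.{1} ↦ S
  have hG := (hR.some.to P).2.comp (hV ⟨⟩)
  obtain ⟨α⟩ := hR.isRigid.nonempty_iso S.reg hF hG.isLogicalFrom
  exact fun i X hX ↦ ⟨_, hG.rank i X hX, ⟨α.app X⟩⟩

theorem IsFreeRankedTopos.exists_isLogical (hR : IsFreeRankedTopos R) (T : StrTopos.{w}) :
    ∃ G : R ⥤ T, IsLogical G := by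
  have hG := (hR.some.to ⟨T, T.str.toRanked⟩).2
  exact ⟨_, hG.isLogicalFrom.isLogical hR.exists_isoRank⟩

theorem IsFreeRankedTopos.isBiInitialTopos (hR : IsFreeRankedTopos R) (hT : IsFreeTopos T) :
    IsBiInitialTopos.{u, w} R := by
  refine ⟨hR.isTopos, fun _ _ hE ↦ ⟨?_, fun _ _ hF hG ↦
    hR.isRigid.nonempty_unique_iso hE.some.reg (hF.isLogicalFrom _) (hG.isLogicalFrom _)⟩⟩
  obtain ⟨G, hG⟩ := hR.exists_isLogical T
  obtain ⟨F, hF⟩ := hT.exists_isLogical hE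
  exact ⟨G ⋙ F, hG.comp hF⟩

theorem exists_equivalence (hT : IsFreeTopos T) (hR : IsFreeRankedTopos R) :
    ∃ e : T ≌ R, IsLogical e.functor ∧ IsLogical e.inverse := by
  obtain ⟨F, hF⟩ := hT.exists_isLogical hR.isTopos
  obtain ⟨G, hG⟩ := hR.exists_isLogical T
  -- Each composite is a logical endofunctor of a free object, hence isomorphic to the identity.
  obtain ⟨η⟩ := hT.isRigid.nonempty_iso T.str.reg (IsLogical.id.isLogicalFrom _)
    ((hF.comp hG).isLogicalFrom _)
  obtain ⟨ε⟩ := hR.isRigid.nonempty_iso R.str.reg ((hG.comp hF).isLogicalFrom _)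
    (IsLogical.id.isLogicalFrom _)
  exact ⟨.mk F G η ε, hF, hG⟩

end Free

end RankedTopos

theorem mainTheorem9 :
    (∃ T : RankedTopos.StrTopos.{w}, RankedTopos.IsFreeTopos T) ∧
    (∃ R : RankedTopos.StrRankedTopos.{w}, RankedTopos.IsFreeRankedTopos R) ∧
    ∀ (T : RankedTopos.StrTopos.{w}) (R : RankedTopos.StrRankedTopos.{w}),
      RankedTopos.IsFreeTopos T → RankedTopos.IsFreeRankedTopos R →
        -- the free `∞`-ranked topos is a topos, and is equivalent to the free topos
        RankedTopos.IsTopos R ∧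
        (∃ e : T ≌ R, RankedTopos.IsLogical e.functor ∧ RankedTopos.IsLogical e.inverse) ∧
        -- logical functors out of the free `∞`-ranked topos preserve rank
        (∀ (E : Type u) [Category.{w} E] (S : RankedTopos.RankedToposStr E) (F : R ⥤ E),
          RankedTopos.IsLogicalFrom R.str F → RankedTopos.PreservesRank R.str S F) ∧
        -- both are bi-initial
        RankedTopos.IsBiInitialTopos.{u, w} T ∧ RankedTopos.IsBiInitialTopos.{u, w} R :=
  ⟨RankedTopos.exists_isFreeTopos, RankedTopos.exists_isFreeRankedTopos, fun _ _ hT hR ↦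
    ⟨hR.isTopos, RankedTopos.exists_equivalence hT hR, fun _ _ S _ hF ↦ hR.preservesRank S hF,
      hT.isBiInitialTopos, hR.isBiInitialTopos hT⟩⟩
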